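/- Let $\mathbb K\in\{\mathbb R,\mathbb C\}$. Let $(A,G,\alpha)$ be a Banach algebra dynamical system: $A$ is a (not necessarily unital) Banach algebra over $\mathbb K$, $G$ is a locally compact Hausdorff group with a fixed left Haar measure, and $\alpha$ is a strongly continuous homomorphism from $G$ into the group of bounded automorphisms of $A$. A continuous covariant representation of $(A,G,\alpha)$ on a Banach space $X$ is a pair $(\pi,U)$, where $\pi:A\to B(X)$ is a bounded algebra homomorphism and $U$ is a strongly continuous homomorphism from $G$ into the group of invertible elements of $B(X)$, such that $\pi(\alpha_s(a))=U_s\pi(a)U_s^{-1}$ for all $a\in A$, $s\in G$. A representation $\pi$ of an algebra on $X$ is non-degenerate if the vectors $\pi(a)x$ span a dense subspace of $X$; $(\pi,U)$ is non-degenerate if $\pi$ is. The integrated form of $(\pi,U)$ is the representation $\pi\rtimes U(f)=\int_G\pi(f(s))U_s\,ds$ (a strong integral) of the algebra $C_c(G,A)$ with product $[f*g](s)=\int_G f(r)\alpha_r(g(r^{-1}s))\,dr$. Let $\mathcal R$ be a non-empty class of continuous covariant representations of $(A,G,\alpha)$ on Banach spaces that is uniformly bounded: there are $C\ge 0$ and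 $\nu:G\to[0,\infty)$, bounded on compact sets, with $\|\pi\|\le C$ and $\|U_r\|\le\nu(r)$ for all $(\pi,U)\in\mathcal R$ and $r\in G$. Put $\sigma^{\mathcal R}(f)=\sup_{(\pi,U)\in\mathcal R}\|\pi\rtimes U(f)\|$ for $f\in C_c(G,A)$. The crossed product $(A\rtimes_\alpha G)^{\mathcal R}$ is the Banach algebra obtained by completing $C_c(G,A)/\ker\sigma^{\mathcal R}$ in the norm induced by $\sigma^{\mathcal R}$; let $q^{\mathcal R}:C_c(G,A)\to(A\rtimes_\alpha G)^{\mathcal R}$ be the canonical homomorphism. The bounded operators $i_A^{\mathcal R}(a)$ and $i_G^{\mathcal R}(r)$ on $(A\rtimes_\alpha G)^{\mathcal R}$ are determined by $i_A^{\mathcal R}(a)q^{\mathcal R}(f)=q^{\mathcal R}(s\mapsto af(s))$ and $i_G^{\mathcal R}(r)q^{\mathcal R}(f)=q^{\mathcal R}(s\mapsto\alpha_r(f(r^{-1}s)))$, for $a\in A$, $r\in G$, $f\in C_c(G,A)$. A covariant representation $(\pi,U)$ on a Banach space $X$ is called $\mathcal R$-continuous if it is continuous and $\|\pi\rtimes U(f)\|\le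 M\sigma^{\mathcal R}(f)$ for some constant $M$ and all $f\in C_c(G,A)$; then $(\pi\rtimes U)^{\mathcal R}:(A\rtimes_\alpha G)^{\mathcal R}\to B(X)$ denotes the bounded representation determined by $(\pi\rtimes U)^{\mathcal R}(q^{\mathcal R}(f))=\pi\rtimes U(f)$. Theorem. Suppose that $A$ has a bounded left approximate identity and that all elements of $\mathcal R$ are non-degenerate. Then the covariant representation $(i_A^{\mathcal R},i_G^{\mathcal R})$ of $(A,G,\alpha)$ on $(A\rtimes_\alpha G)^{\mathcal R}$ is non-degenerate and $\mathcal R$-continuous (in particular continuous), and the associated bounded representation $(i_A^{\mathcal R}\rtimes i_G^{\mathcal R})^{\mathcal R}$ of $(A\rtimes_\alpha G)^{\mathcal R}$ on itself is non-degenerate, coincides with the left regular representation $c\mapsto(d\mapsto c*d)$, and is therefore contractive. -/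

import Mathlib

set_option linter.unusedSectionVars false
set_option linter.style.haveILetI false

universe w

namespace BanachCrossedProduct

open MeasureTheory Filter Topology Set
open scoped CompactlySupported Pointwise

/-! ### Integration of compactly supported continuous functions -/

section Integration

variable (𝕜 : Type*) [RCLike 𝕜] {G : Type*} [MeasurableSpace G]
  {X : Type*} [NormedAddCommGroup X] [NormedSpace 𝕜 X]

/-- The (Bochner) integral `∫_G ψ(s) ds` of a function with values in a Banach space `X` over `𝕜`,
where `𝕜` is the field of real or complex numbers; the space `X` is viewed as a real space by
restriction of scalars. It is only used for continuous functions with compact support. -/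
noncomputable def integral (μ : Measure G) (ψ : G → X) : X :=
  letI : NormedSpace ℝ X := NormedSpace.restrictScalars ℝ 𝕜 X
  ∫ s, ψ s ∂μ

variable {μ : Measure G}

theorem integral_add [TopologicalSpace G] [OpensMeasurableSpace G] [IsFiniteMeasureOnCompacts μ]
    {φ ψ : G → X} (hφ : Continuous φ) (hφ' : HasCompactSupport φ)
    (hψ : Continuous ψ) (hψ' : HasCompactSupport ψ) :
    integral 𝕜 μ (fun s => φ s + ψ s) = integral 𝕜 μ φ + integral 𝕜 μ ψ := by
  letI : NormedSpace ℝ X := NormedSpace.restrictScalars ℝ 𝕜 X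
  exact MeasureTheory.integral_add (hφ.integrable_of_hasCompactSupport hφ')
    (hψ.integrable_of_hasCompactSupport hψ')

theorem map_integral [TopologicalSpace G] [OpensMeasurableSpace G] [IsFiniteMeasureOnCompacts μ]
    {Y : Type*} [NormedAddCommGroup Y] [NormedSpace 𝕜 Y] [CompleteSpace X] [CompleteSpace Y]
    (L : X →L[𝕜] Y) {ψ : G → X} (hψ : Continuous ψ) (hψ' : HasCompactSupport ψ) :
    L (integral 𝕜 μ ψ) = integral 𝕜 μ (fun s => L (ψ s)) := by
  letI : NormedSpace ℝ X := NormedSpace.restrictScalars ℝ 𝕜 X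
  letI : NormedSpace ℝ Y := NormedSpace.restrictScalars ℝ 𝕜 Y
  exact (L.integral_comp_comm (hψ.integrable_of_hasCompactSupport hψ')).symm

theorem integral_zero : integral 𝕜 μ (fun _ => (0 : X)) = 0 := by
  letI : NormedSpace ℝ X := NormedSpace.restrictScalars ℝ 𝕜 X
  exact MeasureTheory.integral_zero G X

theorem integral_mul_left [Group G] [MeasurableMul G] [μ.IsMulLeftInvariant] (ψ : G → X) (r : G) :
    integral 𝕜 μ (fun s => ψ (r * s)) = integral 𝕜 μ ψ := by
  letI : NormedSpace ℝ X := NormedSpace.restrictScalars ℝ 𝕜 X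
  exact integral_mul_left_eq_self ψ r

theorem integral_swap [TopologicalSpace G] [OpensMeasurableSpace G] [IsFiniteMeasureOnCompacts μ]
    {F : G → G → X} (hF : Continuous F.uncurry) (hF' : HasCompactSupport F.uncurry) :
    integral 𝕜 μ (fun s => integral 𝕜 μ (fun r => F s r)) =
      integral 𝕜 μ (fun r => integral 𝕜 μ (fun s => F s r)) := by
  letI : NormedSpace ℝ X := NormedSpace.restrictScalars ℝ 𝕜 X
  exact integral_integral_swap_of_hasCompactSupport hF hF'

theorem norm_integral_le [TopologicalSpace G] [IsFiniteMeasureOnCompacts μ]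
    {ψ : G → X} {K : Set G} (hK : IsCompact K) (hψ : ∀ s, s ∉ K → ψ s = 0) {C : ℝ}
    (hC : ∀ s ∈ K, ‖ψ s‖ ≤ C) :
    ‖integral 𝕜 μ ψ‖ ≤ C * μ.real K := by
  letI : NormedSpace ℝ X := NormedSpace.restrictScalars ℝ 𝕜 X
  have h : ∫ s in K, ψ s ∂μ = ∫ s, ψ s ∂μ :=
    setIntegral_eq_integral_of_forall_compl_eq_zero hψ
  change ‖∫ s, ψ s ∂μ‖ ≤ _
  rw [← h]
  exact norm_setIntegral_le_of_norm_le_const hK.measure_lt_top hC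

theorem continuous_integral [TopologicalSpace G] [OpensMeasurableSpace G]
    [IsFiniteMeasureOnCompacts μ] {Z : Type*} [TopologicalSpace Z]
    {F : Z → G → X} {K : Set G} (hK : IsCompact K) (hF : Continuous F.uncurry)
    (hFK : ∀ z s, s ∉ K → F z s = 0) :
    Continuous fun z => integral 𝕜 μ (F z) := by
  letI : NormedSpace ℝ X := NormedSpace.restrictScalars ℝ 𝕜 X
  rw [← continuousOn_univ]
  exact continuousOn_integral_of_compact_support hK hF.continuousOn (fun p x _ hx => hFK p x hx)

end Integration

/-! ### Strongly continuous families of operators -/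

section Strong

variable {𝕜 : Type*} [RCLike 𝕜] {G : Type*} [TopologicalSpace G]
  {X : Type*} [NormedAddCommGroup X] [NormedSpace 𝕜 X] [CompleteSpace X]

theorem exists_bound_of_strongly_continuous {T : G → X →L[𝕜] X}
    (hT : ∀ x, Continuous fun s => T s x) {K : Set G} (hK : IsCompact K) :
    ∃ M, ∀ s ∈ K, ‖T s‖ ≤ M := by
  obtain ⟨M, hM⟩ := banach_steinhaus (g := fun s : K => T s) (fun x => by
    obtain ⟨C, hC⟩ := hK.exists_bound_of_continuousOn (hT x).continuousOn
    exact ⟨C, fun s => hC s s.2⟩)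
  exact ⟨M, fun s hs => hM ⟨s, hs⟩⟩

theorem continuous_uncurry_of_strongly_continuous [LocallyCompactSpace G] {T : G → X →L[𝕜] X}
    (hT : ∀ x, Continuous fun s => T s x) : Continuous fun p : G × X => T p.1 p.2 := by
  rw [continuous_iff_continuousAt]
  rintro ⟨s₀, x₀⟩
  obtain ⟨K, hK, hKs⟩ := exists_compact_mem_nhds s₀
  obtain ⟨M, hM⟩ := exists_bound_of_strongly_continuous hT hK
  rw [ContinuousAt, tendsto_iff_norm_sub_tendsto_zero]
  have h1 : Tendsto (fun p : G × X => M * ‖p.2 - x₀‖ + ‖T p.1 x₀ - T s₀ x₀‖) (𝓝 (s₀, x₀)) (𝓝 0) := by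
    have hc : Continuous (fun p : G × X => M * ‖p.2 - x₀‖ + ‖T p.1 x₀ - T s₀ x₀‖) := by
      have := (hT x₀).comp (continuous_fst : Continuous (Prod.fst : G × X → G))
      simp only [Function.comp_def] at this
      fun_prop
    simpa using hc.tendsto (s₀, x₀)
  refine squeeze_zero' (Eventually.of_forall fun _ => norm_nonneg _) ?_ h1
  have h2 : ∀ᶠ p : G × X in 𝓝 (s₀, x₀), p.1 ∈ K := continuous_fst.continuousAt hKs
  filter_upwards [h2] with p hp
  calc ‖T p.1 p.2 - T s₀ x₀‖ = ‖T p.1 (p.2 - x₀) + (T p.1 x₀ - T s₀ x₀)‖ := by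
        rw [map_sub]; congr 1; abel
    _ ≤ ‖T p.1 (p.2 - x₀)‖ + ‖T p.1 x₀ - T s₀ x₀‖ := norm_add_le _ _
    _ ≤ M * ‖p.2 - x₀‖ + ‖T p.1 x₀ - T s₀ x₀‖ := by
        gcongr
        exact (T p.1).le_of_opNorm_le (hM _ hp) _

theorem continuous_apply_of_strongly_continuous [LocallyCompactSpace G] {T : G → X →L[𝕜] X}
    (hT : ∀ x, Continuous fun s => T s x) {Z : Type*} [TopologicalSpace Z] {g : Z → G} {h : Z → X}
    (hg : Continuous g) (hh : Continuous h) : Continuous fun z => T (g z) (h z) :=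
  (continuous_uncurry_of_strongly_continuous hT).comp (hg.prodMk hh)

end Strong

/-! ### Dynamical systems and covariant representations -/

section Systems

variable (𝕜 : Type*) [RCLike 𝕜]
  (A : Type*) [NonUnitalNormedRing A] [NormedSpace 𝕜 A]
  (G : Type*) [Group G] [TopologicalSpace G]

/-- An action of a group `G` on a (not necessarily unital) normed algebra `A` over `𝕜` by bounded
automorphisms, strongly continuous. If `A` is complete and `G` is a locally compact Hausdorff
group, this is a Banach algebra dynamical system `(A, G, α)`.

As `α` is multiplicative on a group and `α 1 = 1`, each `α s` is invertible in the bounded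
operators on `A`, with inverse `α s⁻¹`; hence each `α s` is a bounded automorphism of `A`. -/
structure DynamicalSystem where
  /-- the action -/
  α : G →* (A →L[𝕜] A)
  map_mul : ∀ (s : G) (a b : A), α s (a * b) = α s a * α s b
  strongly_continuous : ∀ a : A, Continuous fun s => α s a

variable {𝕜 A G}

/-- A representation of an algebra on a normed space `X` is non-degenerate if the vectors `π(b) x`
span a dense subspace of `X`. -/
def IsNondegenerate {B : Type*} [NonUnitalNonAssocSemiring B] [Module 𝕜 B]
    {X : Type*} [NormedAddCommGroup X] [NormedSpace 𝕜 X] (π : B →ₙₐ[𝕜] (X →L[𝕜] X)) : Prop :=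
  Dense (Submodule.span 𝕜 {y : X | ∃ (b : B) (x : X), π b x = y} : Set X)

/-- A bounded left approximate identity: a bounded net `(uᵢ)` in `A` with `uᵢ a → a` for all `a`,
expressed through the corresponding filter on `A`. -/
def HasBoundedLeftApproximateIdentity (A : Type*) [NonUnitalNormedRing A] : Prop :=
  ∃ l : Filter A, l.NeBot ∧ (∃ M : ℝ, ∀ᶠ u in l, ‖u‖ ≤ M) ∧ ∀ a : A, Tendsto (fun u => u * a) l (𝓝 a)

/-- A covariant representation `(π, U)` of `(A, G, α)` on a normed space `X`. No continuity of `π`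
or `U` is assumed. Every `U s` is invertible in the bounded operators on `X`, with inverse
`U s⁻¹`. -/
structure CovariantRep (S : DynamicalSystem 𝕜 A G)
    (X : Type*) [NormedAddCommGroup X] [NormedSpace 𝕜 X] where
  /-- the representation of the algebra -/
  π : A →ₙₐ[𝕜] (X →L[𝕜] X)
  /-- the representation of the group -/
  U : G →* (X →L[𝕜] X)
  covariant : ∀ (a : A) (s : G), π (S.α s a) = U s * π a * U s⁻¹

/-- `(π, U)` is continuous if `π` is norm bounded and `U` is strongly continuous. -/
structure CovariantRep.IsContinuous {S : DynamicalSystem 𝕜 A G}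
    {X : Type*} [NormedAddCommGroup X] [NormedSpace 𝕜 X] (ρ : CovariantRep S X) : Prop where
  bounded : ∃ C : ℝ, ∀ a, ‖ρ.π a‖ ≤ C * ‖a‖
  strongly_continuous : ∀ x, Continuous fun s => ρ.U s x

/-- A continuous covariant representation on some Banach space. -/
structure BanachCovariantRep (S : DynamicalSystem 𝕜 A G) where
  /-- the representation space -/
  X : Type w
  [normedAddCommGroup : NormedAddCommGroup X]
  [normedSpace : NormedSpace 𝕜 X]
  [completeSpace : CompleteSpace X]
  /-- the pair `(π, U)` -/
  rep : CovariantRep S X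
  isContinuous : rep.IsContinuous

attribute [instance] BanachCovariantRep.normedAddCommGroup BanachCovariantRep.normedSpace
  BanachCovariantRep.completeSpace

/-- A non-empty uniformly bounded class of continuous covariant representations of `(A, G, α)` on
Banach spaces. -/
structure UniformlyBoundedClass (S : DynamicalSystem 𝕜 A G) where
  /-- the class of representations -/
  carrier : Set (BanachCovariantRep.{w} S)
  nonempty : carrier.Nonempty
  uniformly_bounded : ∃ (C : ℝ) (ν : G → ℝ),
    (∀ K : Set G, IsCompact K → BddAbove (ν '' K)) ∧
    ∀ ρ ∈ carrier, (∀ a, ‖ρ.rep.π a‖ ≤ C * ‖a‖) ∧ ∀ r, ‖ρ.rep.U r‖ ≤ ν r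

end Systems

/-! ### The twisted convolution algebra `C_c(G, A)` -/

section Convolution

variable {𝕜 : Type*} [RCLike 𝕜]
  {A : Type*} [NonUnitalNormedRing A] [NormedSpace 𝕜 A]
  {G : Type*} [Group G] [TopologicalSpace G] [MeasurableSpace G]

/-- The space `C_c(G, A)`, to be equipped with the twisted convolution product (and not with the
pointwise product). -/
def ConvAlg (_S : DynamicalSystem 𝕜 A G) (_μ : Measure G) : Type _ := C_c(G, A)

variable {S : DynamicalSystem 𝕜 A G} {μ : Measure G}

noncomputable instance : AddCommGroup (ConvAlg S μ) := inferInstanceAs (AddCommGroup C_c(G, A))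
noncomputable instance : Module 𝕜 (ConvAlg S μ) := inferInstanceAs (Module 𝕜 C_c(G, A))
instance : FunLike (ConvAlg S μ) G A := inferInstanceAs (FunLike C_c(G, A) G A)

namespace ConvAlg

@[ext] theorem ext {f g : ConvAlg S μ} (h : ∀ s, f s = g s) : f = g :=
  CompactlySupportedContinuousMap.ext h

theorem continuous (f : ConvAlg S μ) : Continuous f :=
  ContinuousMap.continuous (CompactlySupportedContinuousMap.toContinuousMap f)
theorem hasCompactSupport (f : ConvAlg S μ) : HasCompactSupport f :=
  CompactlySupportedContinuousMap.hasCompactSupport' f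

/-- A continuous function with compact support, as an element of `C_c(G, A)`. -/
def mk (f : G → A) (hf : Continuous f) (hf' : HasCompactSupport f) : ConvAlg S μ :=
  (⟨⟨f, hf⟩, hf'⟩ : C_c(G, A))

@[simp] theorem mk_apply (f : G → A) (hf : Continuous f) (hf' : HasCompactSupport f) (s : G) :
    (mk f hf hf' : ConvAlg S μ) s = f s := rfl

@[simp] theorem add_apply (f g : ConvAlg S μ) (s : G) : (f + g) s = f s + g s := rfl
@[simp] theorem smul_apply (c : 𝕜) (f : ConvAlg S μ) (s : G) : (c • f) s = c • f s := rfl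
@[simp] theorem zero_apply (s : G) : (0 : ConvAlg S μ) s = 0 := rfl

theorem eq_zero_of_notMem (f : ConvAlg S μ) {s : G} (hs : s ∉ tsupport f) : f s = 0 :=
  image_eq_zero_of_notMem_tsupport hs

end ConvAlg

variable [IsScalarTower 𝕜 A A] [SMulCommClass 𝕜 A A] [CompleteSpace A]
  [IsTopologicalGroup G] [LocallyCompactSpace G] [T2Space G] [BorelSpace G] [μ.IsHaarMeasure]

namespace ConvAlg

theorem continuous_act {Z : Type*} [TopologicalSpace Z] {g : Z → G} {h : Z → A}
    (hg : Continuous g) (hh : Continuous h) : Continuous fun z => S.α (g z) (h z) :=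
  continuous_apply_of_strongly_continuous S.strongly_continuous hg hh

theorem continuous_kernel (f g : ConvAlg S μ) :
    Continuous fun p : G × G => f p.2 * S.α p.2 (g (p.2⁻¹ * p.1)) :=
  (f.continuous.comp continuous_snd).mul
    (continuous_act continuous_snd (g.continuous.comp (by fun_prop)))

theorem kernel_eq_zero (f g : ConvAlg S μ) {s : G} (r : G) (hs : s ∉ tsupport f * tsupport g) :
    f r * S.α r (g (r⁻¹ * s)) = 0 := by
  by_cases hr : r ∈ tsupport f
  · have : r⁻¹ * s ∉ tsupport g := fun h => hs ⟨r, hr, r⁻¹ * s, h, by simp⟩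
    rw [g.eq_zero_of_notMem this]; simp
  · rw [f.eq_zero_of_notMem hr]; simp

theorem isCompact_mul_tsupport (f g : ConvAlg S μ) : IsCompact (tsupport f * tsupport g) :=
  f.hasCompactSupport.isCompact.mul g.hasCompactSupport.isCompact

/-- Twisted convolution: `[f * g](s) = ∫_G f(r) α_r(g(r⁻¹ s)) dr`. -/
noncomputable instance : Mul (ConvAlg S μ) where
  mul f g := mk (fun s => integral 𝕜 μ fun r => f r * S.α r (g (r⁻¹ * s)))
    (continuous_integral 𝕜 (F := fun s r => f r * S.α r (g (r⁻¹ * s)))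
      f.hasCompactSupport.isCompact (continuous_kernel f g)
      (fun s r hr => by rw [f.eq_zero_of_notMem hr]; simp))
    (HasCompactSupport.intro (isCompact_mul_tsupport f g) (fun s hs => by
      simp only [kernel_eq_zero f g _ hs, integral_zero]))

theorem mul_apply (f g : ConvAlg S μ) (s : G) :
    (f * g) s = integral 𝕜 μ fun r => f r * S.α r (g (r⁻¹ * s)) := rfl

theorem continuous_kernel' (f g : ConvAlg S μ) (s : G) :
    Continuous fun r => f r * S.α r (g (r⁻¹ * s)) :=
  (continuous_kernel f g).comp (by fun_prop : Continuous fun r : G => (s, r))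

theorem hasCompactSupport_kernel' (f g : ConvAlg S μ) (s : G) :
    HasCompactSupport fun r => f r * S.α r (g (r⁻¹ * s)) :=
  HasCompactSupport.intro f.hasCompactSupport.isCompact
    (fun r hr => by rw [f.eq_zero_of_notMem hr]; simp)

theorem add_mul' (f g h : ConvAlg S μ) : (f + g) * h = f * h + g * h := by
  ext s
  simp only [mul_apply, add_apply, add_mul]
  exact integral_add 𝕜 (continuous_kernel' f h s) (hasCompactSupport_kernel' f h s)
    (continuous_kernel' g h s) (hasCompactSupport_kernel' g h s)

theorem mul_add' (f g h : ConvAlg S μ) : f * (g + h) = f * g + f * h := by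
  ext s
  simp only [mul_apply, add_apply, mul_add, map_add]
  exact integral_add 𝕜 (continuous_kernel' f g s) (hasCompactSupport_kernel' f g s)
    (continuous_kernel' f h s) (hasCompactSupport_kernel' f h s)

theorem zero_mul' (f : ConvAlg S μ) : 0 * f = 0 := by
  have := add_mul' 0 0 f
  simpa using this

theorem mul_zero' (f : ConvAlg S μ) : f * 0 = 0 := by
  have := mul_add' f 0 0
  simpa using this

theorem smul_mul' (c : 𝕜) (f g : ConvAlg S μ) : (c • f) * g = c • (f * g) := by
  ext s
  simp only [mul_apply, smul_apply, smul_mul_assoc]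
  exact (map_integral 𝕜 (c • ContinuousLinearMap.id 𝕜 A) (continuous_kernel' f g s)
    (hasCompactSupport_kernel' f g s)).symm

theorem mul_smul' (c : 𝕜) (f g : ConvAlg S μ) : f * (c • g) = c • (f * g) := by
  ext s
  simp only [mul_apply, smul_apply, map_smul, mul_smul_comm]
  exact (map_integral 𝕜 (c • ContinuousLinearMap.id 𝕜 A) (continuous_kernel' f g s)
    (hasCompactSupport_kernel' f g s)).symm

theorem α_mul_apply (r t : G) (a : A) : S.α (r * t) a = S.α r (S.α t a) := by
  rw [map_mul]; rfl

theorem mul_assoc' (f g h : ConvAlg S μ) : f * g * h = f * (g * h) := by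
  ext s
  have hF : Continuous (fun p : G × G => f p.2 * S.α p.2 (g (p.2⁻¹ * p.1)) *
      S.α p.1 (h (p.1⁻¹ * s))) :=
    (continuous_kernel f g).mul
      (continuous_act continuous_fst (h.continuous.comp (by fun_prop)))
  have hF' : HasCompactSupport (fun p : G × G => f p.2 * S.α p.2 (g (p.2⁻¹ * p.1)) *
      S.α p.1 (h (p.1⁻¹ * s))) := by
    refine HasCompactSupport.intro
      ((isCompact_mul_tsupport f g).prod f.hasCompactSupport.isCompact) ?_
    rintro ⟨t, r⟩ hp
    rw [mem_prod, not_and_or] at hp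
    rcases hp with hp | hp
    · simp only at hp ⊢
      rw [kernel_eq_zero f g r hp, zero_mul]
    · simp only at hp ⊢
      rw [f.eq_zero_of_notMem hp]; simp
  calc (f * g * h) s
      = integral 𝕜 μ fun t => integral 𝕜 μ fun r =>
          f r * S.α r (g (r⁻¹ * t)) * S.α t (h (t⁻¹ * s)) := by
        simp only [mul_apply]
        congr 1; funext t
        exact map_integral 𝕜 ((ContinuousLinearMap.mul 𝕜 A).flip (S.α t (h (t⁻¹ * s))))
          (continuous_kernel' f g t) (hasCompactSupport_kernel' f g t)
    _ = integral 𝕜 μ fun r => integral 𝕜 μ fun t =>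
          f r * S.α r (g (r⁻¹ * t)) * S.α t (h (t⁻¹ * s)) :=
        integral_swap 𝕜 (F := fun t r => f r * S.α r (g (r⁻¹ * t)) * S.α t (h (t⁻¹ * s))) hF hF'
    _ = (f * (g * h)) s := by
        simp only [mul_apply]
        congr 1; funext r
        rw [← integral_mul_left 𝕜 _ r]
        have := map_integral 𝕜 (μ := μ) ((ContinuousLinearMap.mul 𝕜 A (f r)).comp (S.α r))
          (continuous_kernel' g h (r⁻¹ * s)) (hasCompactSupport_kernel' g h (r⁻¹ * s))
        simp only [ContinuousLinearMap.comp_apply, ContinuousLinearMap.mul_apply'] at this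
        rw [this]
        congr 1; funext t
        simp only [S.map_mul, α_mul_apply, mul_inv_rev, mul_assoc, inv_mul_cancel_left]

noncomputable instance : NonUnitalRing (ConvAlg S μ) where
  left_distrib := mul_add'
  right_distrib := add_mul'
  zero_mul := zero_mul'
  mul_zero := mul_zero'
  mul_assoc := mul_assoc'

instance : IsScalarTower 𝕜 (ConvAlg S μ) (ConvAlg S μ) := ⟨fun c f g => smul_mul' c f g⟩
instance : SMulCommClass 𝕜 (ConvAlg S μ) (ConvAlg S μ) := ⟨fun c f g => (mul_smul' c f g).symm⟩

/-- The operator `[i_A(a) f](s) = a f(s)` on `C_c(G, A)`. -/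
noncomputable def iA (a : A) (f : ConvAlg S μ) : ConvAlg S μ :=
  mk (fun s => a * f s) (continuous_const.mul f.continuous)
    (HasCompactSupport.intro f.hasCompactSupport.isCompact
      (fun s hs => by rw [f.eq_zero_of_notMem hs, mul_zero]))

/-- The operator `[i_G(r) f](s) = α_r(f(r⁻¹ s))` on `C_c(G, A)`. -/
noncomputable def iG (r : G) (f : ConvAlg S μ) : ConvAlg S μ :=
  mk (fun s => S.α r (f (r⁻¹ * s))) ((S.α r).continuous.comp (f.continuous.comp (by fun_prop)))
    (HasCompactSupport.intro
      ((isCompact_singleton (x := r)).mul f.hasCompactSupport.isCompact)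
      (fun s hs => by
        have : r⁻¹ * s ∉ tsupport f := fun h => hs ⟨r, rfl, r⁻¹ * s, h, by simp⟩
        rw [f.eq_zero_of_notMem this, map_zero]))

@[simp] theorem iA_apply (a : A) (f : ConvAlg S μ) (s : G) : iA a f s = a * f s := rfl
@[simp] theorem iG_apply (r : G) (f : ConvAlg S μ) (s : G) : iG r f s = S.α r (f (r⁻¹ * s)) := rfl

end ConvAlg

end Convolution

/-! ### Integrated forms -/

section IntegratedForm

variable {𝕜 : Type*} [RCLike 𝕜]
  {A : Type*} [NonUnitalNormedRing A] [NormedSpace 𝕜 A]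
  [IsScalarTower 𝕜 A A] [SMulCommClass 𝕜 A A] [CompleteSpace A]
  {G : Type*} [Group G] [TopologicalSpace G] [IsTopologicalGroup G] [LocallyCompactSpace G]
  [T2Space G] [MeasurableSpace G] [BorelSpace G]
  {S : DynamicalSystem 𝕜 A G}
  {X : Type*} [NormedAddCommGroup X] [NormedSpace 𝕜 X] [CompleteSpace X]

namespace CovariantRep

variable {ρ : CovariantRep S X}

theorem continuous_π (h : ρ.IsContinuous) : Continuous ρ.π := by
  obtain ⟨C, hC⟩ := h.bounded
  let L : A →ₗ[𝕜] (X →L[𝕜] X) :=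
    { toFun := ρ.π, map_add' := map_add ρ.π, map_smul' := map_smul ρ.π }
  exact (L.mkContinuous C hC).continuous

theorem continuous_π_U (h : ρ.IsContinuous) {Z : Type*} [TopologicalSpace Z] {a : Z → A} {g : Z → G}
    {x : Z → X} (ha : Continuous a) (hg : Continuous g) (hx : Continuous x) :
    Continuous fun z => ρ.π (a z) (ρ.U (g z) (x z)) :=
  ((continuous_π h).comp ha).clm_apply
    (continuous_apply_of_strongly_continuous h.strongly_continuous hg hx)

variable {μ : Measure G} [μ.IsHaarMeasure]

theorem continuous_integrand (h : ρ.IsContinuous) (f : ConvAlg S μ) (x : X) :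
    Continuous fun s => ρ.π (f s) (ρ.U s x) :=
  continuous_π_U h f.continuous continuous_id continuous_const

theorem integrand_eq_zero (f : ConvAlg S μ) (x : X) (s : G) (hs : s ∉ tsupport f) :
    ρ.π (f s) (ρ.U s x) = 0 := by
  rw [f.eq_zero_of_notMem hs]; simp

theorem hasCompactSupport_integrand (f : ConvAlg S μ) (x : X) :
    HasCompactSupport fun s => ρ.π (f s) (ρ.U s x) :=
  HasCompactSupport.intro f.hasCompactSupport.isCompact (integrand_eq_zero f x)

theorem exists_norm_integral_le {C : ℝ} {ν : G → ℝ} (hC : ∀ a, ‖ρ.π a‖ ≤ C * ‖a‖)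
    (f : ConvAlg S μ) {M N : ℝ} (hM : ∀ s, ‖f s‖ ≤ M) (hν : ∀ s ∈ tsupport f, ν s ≤ N)
    (hU : ∀ s ∈ tsupport f, ‖ρ.U s‖ ≤ ν s) (x : X) :
    ‖integral 𝕜 μ fun s => ρ.π (f s) (ρ.U s x)‖ ≤
      (|C| * M * N * μ.real (tsupport f)) * ‖x‖ := by
  have h := norm_integral_le 𝕜 (μ := μ) (ψ := fun s => ρ.π (f s) (ρ.U s x))
    (C := |C| * M * (N * ‖x‖)) f.hasCompactSupport.isCompact (integrand_eq_zero f x) (fun s hs => by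
      have hM0 : 0 ≤ M := (norm_nonneg _).trans (hM s)
      have h1 : ‖ρ.π (f s)‖ ≤ |C| * M := (hC _).trans (by
        gcongr
        · exact le_abs_self C
        · exact hM s)
      have h2 : ‖ρ.U s x‖ ≤ N * ‖x‖ := (ρ.U s).le_of_opNorm_le ((hU s hs).trans (hν s hs)) x
      exact (ρ.π (f s)).le_of_opNorm_le_of_le h1 h2)
  refine h.trans_eq (by ring)

theorem exists_bound (h : ρ.IsContinuous) (f : ConvAlg S μ) :
    ∃ M : ℝ, ∀ x, ‖integral 𝕜 μ fun s => ρ.π (f s) (ρ.U s x)‖ ≤ M * ‖x‖ := by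
  obtain ⟨C, hC⟩ := h.bounded
  obtain ⟨M, hM⟩ := f.continuous.bounded_above_of_compact_support f.hasCompactSupport
  obtain ⟨N, hN⟩ := exists_bound_of_strongly_continuous h.strongly_continuous
    f.hasCompactSupport.isCompact
  exact ⟨_, fun x => exists_norm_integral_le (ν := fun s => ‖ρ.U s‖) hC f hM hN (fun _ _ => le_rfl) x⟩

/-- The operator `π ⋊ U (f) = ∫_G π(f(s)) U_s ds` on `X`, the integral being taken in the strong
sense, i.e. `π ⋊ U (f) x = ∫_G π(f(s)) U_s x ds`. -/
noncomputable def integratedOperator (h : ρ.IsContinuous) (f : ConvAlg S μ) : X →L[𝕜] X :=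
  LinearMap.mkContinuousOfExistsBound
    { toFun := fun x => integral 𝕜 μ fun s => ρ.π (f s) (ρ.U s x)
      map_add' := fun x y => by
        simp only [map_add]
        exact integral_add 𝕜 (continuous_integrand h f x) (hasCompactSupport_integrand f x)
          (continuous_integrand h f y) (hasCompactSupport_integrand f y)
      map_smul' := fun c x => by
        simp only [map_smul, RingHom.id_apply]
        exact (map_integral 𝕜 (c • ContinuousLinearMap.id 𝕜 X) (continuous_integrand h f x)
          (hasCompactSupport_integrand f x)).symm }
    (exists_bound h f)

theorem integratedOperator_apply (h : ρ.IsContinuous) (f : ConvAlg S μ) (x : X) :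
    integratedOperator h f x = integral 𝕜 μ fun s => ρ.π (f s) (ρ.U s x) := rfl

theorem U_mul_apply (r s : G) (x : X) : ρ.U (r * s) x = ρ.U r (ρ.U s x) := by
  rw [map_mul]; rfl

theorem π_α_U (a : A) (r s : G) (x : X) :
    ρ.π (S.α r a) (ρ.U (r * s) x) = ρ.U r (ρ.π a (ρ.U s x)) := by
  rw [ρ.covariant]
  simp only [mul_apply_eq_comp, ← U_mul_apply, inv_mul_cancel_left]

theorem integratedOperator_iA (h : ρ.IsContinuous) (a : A) (f : ConvAlg S μ) :
    integratedOperator h (f.iA a) = ρ.π a * integratedOperator h f := by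
  ext x
  simp only [integratedOperator_apply, mul_apply_eq_comp, ConvAlg.iA_apply, map_mul]
  exact (map_integral 𝕜 (ρ.π a) (continuous_integrand h f x)
    (hasCompactSupport_integrand f x)).symm

theorem integratedOperator_iG (h : ρ.IsContinuous) (r : G) (f : ConvAlg S μ) :
    integratedOperator h (f.iG r) = ρ.U r * integratedOperator h f := by
  ext x
  simp only [integratedOperator_apply, mul_apply_eq_comp]
  rw [← integral_mul_left 𝕜 _ r, map_integral 𝕜 (ρ.U r) (continuous_integrand h f x)
    (hasCompactSupport_integrand f x)]
  simp only [ConvAlg.iG_apply, inv_mul_cancel_left, π_α_U]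

theorem integratedOperator_mul (h : ρ.IsContinuous) (f g : ConvAlg S μ) :
    integratedOperator h (f * g) = integratedOperator h f * integratedOperator h g := by
  ext x
  have hF : Continuous (fun p : G × G =>
      ρ.π (f p.2 * S.α p.2 (g (p.2⁻¹ * p.1))) (ρ.U p.1 x)) :=
    continuous_π_U h (ConvAlg.continuous_kernel f g) continuous_fst continuous_const
  have hF' : HasCompactSupport (fun p : G × G =>
      ρ.π (f p.2 * S.α p.2 (g (p.2⁻¹ * p.1))) (ρ.U p.1 x)) := by
    refine HasCompactSupport.intro
      ((ConvAlg.isCompact_mul_tsupport f g).prod f.hasCompactSupport.isCompact) ?_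
    rintro ⟨t, r⟩ hp
    rw [mem_prod, not_and_or] at hp
    rcases hp with hp | hp
    · simp only at hp ⊢
      rw [ConvAlg.kernel_eq_zero f g r hp]; simp
    · simp only at hp ⊢
      rw [f.eq_zero_of_notMem hp]; simp
  calc integratedOperator h (f * g) x
      = integral 𝕜 μ fun t => integral 𝕜 μ fun r =>
          ρ.π (f r * S.α r (g (r⁻¹ * t))) (ρ.U t x) := by
        simp only [integratedOperator_apply, ConvAlg.mul_apply]
        congr 1; funext t
        exact map_integral 𝕜
          (L := ((ContinuousLinearMap.apply 𝕜 X (ρ.U t x)).comp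
            (⟨{ toFun := ρ.π, map_add' := map_add ρ.π, map_smul' := map_smul ρ.π },
              continuous_π h⟩ : A →L[𝕜] (X →L[𝕜] X))))
          (ConvAlg.continuous_kernel' f g t) (ConvAlg.hasCompactSupport_kernel' f g t)
    _ = integral 𝕜 μ fun r => integral 𝕜 μ fun t =>
          ρ.π (f r * S.α r (g (r⁻¹ * t))) (ρ.U t x) :=
        integral_swap 𝕜 (F := fun t r => ρ.π (f r * S.α r (g (r⁻¹ * t))) (ρ.U t x)) hF hF'
    _ = (integratedOperator h f * integratedOperator h g) x := by
        simp only [integratedOperator_apply, mul_apply_eq_comp]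
        congr 1; funext r
        rw [← integral_mul_left 𝕜 _ r]
        have := map_integral 𝕜 (μ := μ) ((ρ.π (f r)).comp (ρ.U r))
          (continuous_integrand h g x) (hasCompactSupport_integrand g x)
        simp only [ContinuousLinearMap.comp_apply] at this
        rw [this]
        congr 1; funext t
        simp only [map_mul ρ.π, mul_apply_eq_comp, inv_mul_cancel_left, π_α_U]

/-- The integrated form `π ⋊ U` of a continuous covariant representation `(π, U)`, as a
representation of the algebra `C_c(G, A)` with twisted convolution. -/
noncomputable def integratedForm (μ : Measure G) [μ.IsHaarMeasure] (h : ρ.IsContinuous) :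
    ConvAlg S μ →ₙₐ[𝕜] (X →L[𝕜] X) where
  toFun := integratedOperator h
  map_smul' c f := by
    ext x
    simp only [integratedOperator_apply, ConvAlg.smul_apply, map_smul]
    exact (map_integral 𝕜 (c • ContinuousLinearMap.id 𝕜 X) (continuous_integrand h f x)
      (hasCompactSupport_integrand f x)).symm
  map_zero' := by
    ext x
    simp [integratedOperator_apply, integral_zero]
  map_add' f g := by
    ext x
    simp only [integratedOperator_apply, ConvAlg.add_apply, map_add, _root_.add_apply]
    exact integral_add 𝕜 (continuous_integrand h f x) (hasCompactSupport_integrand f x)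
      (continuous_integrand h g x) (hasCompactSupport_integrand g x)
  map_mul' := integratedOperator_mul h

theorem integratedForm_apply (h : ρ.IsContinuous) (f : ConvAlg S μ) (x : X) :
    integratedForm μ h f x = integral 𝕜 μ fun s => ρ.π (f s) (ρ.U s x) := rfl

theorem integratedForm_iA (h : ρ.IsContinuous) (a : A) (f : ConvAlg S μ) :
    integratedForm μ h (f.iA a) = ρ.π a * integratedForm μ h f := integratedOperator_iA h a f

theorem integratedForm_iG (h : ρ.IsContinuous) (r : G) (f : ConvAlg S μ) :
    integratedForm μ h (f.iG r) = ρ.U r * integratedForm μ h f := integratedOperator_iG h r f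

end CovariantRep

/-! ### The seminorm -/

namespace UniformlyBoundedClass

variable (R : UniformlyBoundedClass.{w} S) (μ : Measure G) [μ.IsHaarMeasure]

/-- The seminorm `σ^R(f) = sup_{(π, U) ∈ R} ‖π ⋊ U (f)‖` on `C_c(G, A)`. The supremum is finite by
`bddAbove`. -/
noncomputable def seminorm (f : ConvAlg S μ) : ℝ :=
  ⨆ ρ : R.carrier, ‖CovariantRep.integratedForm μ ρ.1.isContinuous f‖

variable {μ}

instance : Nonempty R.carrier := R.nonempty.to_subtype

theorem bddAbove (f : ConvAlg S μ) :
    BddAbove (range fun ρ : R.carrier => ‖CovariantRep.integratedForm μ ρ.1.isContinuous f‖) := by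
  obtain ⟨C, ν, hν, hR⟩ := R.uniformly_bounded
  obtain ⟨M, hM⟩ := f.continuous.bounded_above_of_compact_support f.hasCompactSupport
  obtain ⟨N, hN⟩ := hν _ f.hasCompactSupport.isCompact
  have hN' : ∀ s ∈ tsupport f, ν s ≤ |N| := fun s hs =>
    (hN (mem_image_of_mem ν hs)).trans (le_abs_self N)
  refine ⟨|C| * M * |N| * μ.real (tsupport f), ?_⟩
  rintro _ ⟨ρ, rfl⟩
  have hM0 : 0 ≤ M := (norm_nonneg _).trans (hM 1)
  refine ContinuousLinearMap.opNorm_le_bound _ (by positivity) (fun x => ?_)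
  exact CovariantRep.exists_norm_integral_le (hR ρ.1 ρ.2).1 f hM hN' (fun s _ => (hR ρ.1 ρ.2).2 s) x

theorem le_seminorm {ρ : BanachCovariantRep.{w} S} (hρ : ρ ∈ R.carrier) (f : ConvAlg S μ) :
    ‖CovariantRep.integratedForm μ ρ.isContinuous f‖ ≤ R.seminorm μ f :=
  le_ciSup (R.bddAbove f) ⟨ρ, hρ⟩

theorem seminorm_le {f : ConvAlg S μ} {c : ℝ}
    (h : ∀ ρ ∈ R.carrier, ‖CovariantRep.integratedForm μ ρ.isContinuous f‖ ≤ c) :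
    R.seminorm μ f ≤ c :=
  ciSup_le fun ρ => h ρ.1 ρ.2

theorem seminorm_nonneg (f : ConvAlg S μ) : 0 ≤ R.seminorm μ f :=
  Real.iSup_nonneg fun _ => norm_nonneg _

theorem seminorm_zero : R.seminorm μ 0 = 0 :=
  le_antisymm (R.seminorm_le fun ρ _ => by simp) (R.seminorm_nonneg 0)

theorem seminorm_neg (f : ConvAlg S μ) : R.seminorm μ (-f) = R.seminorm μ f := by
  simp only [seminorm, map_neg, norm_neg]

theorem seminorm_add_le (f g : ConvAlg S μ) :
    R.seminorm μ (f + g) ≤ R.seminorm μ f + R.seminorm μ g :=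
  R.seminorm_le fun ρ hρ => by
    rw [map_add]
    exact (norm_add_le _ _).trans (add_le_add (R.le_seminorm hρ f) (R.le_seminorm hρ g))

theorem seminorm_mul_le (f g : ConvAlg S μ) :
    R.seminorm μ (f * g) ≤ R.seminorm μ f * R.seminorm μ g :=
  R.seminorm_le fun ρ hρ => by
    rw [map_mul]
    exact (norm_mul_le _ _).trans (mul_le_mul (R.le_seminorm hρ f) (R.le_seminorm hρ g)
      (norm_nonneg _) (R.seminorm_nonneg f))

theorem seminorm_smul_le (c : 𝕜) (f : ConvAlg S μ) :
    R.seminorm μ (c • f) ≤ ‖c‖ * R.seminorm μ f :=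
  R.seminorm_le fun ρ hρ => by
    rw [map_smul, norm_smul]
    exact mul_le_mul_of_nonneg_left (R.le_seminorm hρ f) (norm_nonneg c)

theorem exists_seminorm_iA_le :
    ∃ C : ℝ, 0 ≤ C ∧ ∀ (a : A) (f : ConvAlg S μ),
      R.seminorm μ (f.iA a) ≤ C * ‖a‖ * R.seminorm μ f := by
  obtain ⟨C, ν, -, hR⟩ := R.uniformly_bounded
  refine ⟨|C|, abs_nonneg C, fun a f => R.seminorm_le fun ρ hρ => ?_⟩
  rw [CovariantRep.integratedForm_iA]
  refine (norm_mul_le _ _).trans (mul_le_mul ?_ (R.le_seminorm hρ f) (norm_nonneg _) (by positivity))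
  exact ((hR ρ hρ).1 a).trans (mul_le_mul_of_nonneg_right (le_abs_self C) (norm_nonneg a))

theorem exists_seminorm_iG_le (r : G) :
    ∃ C : ℝ, ∀ f : ConvAlg S μ, R.seminorm μ (f.iG r) ≤ C * R.seminorm μ f := by
  obtain ⟨C, ν, -, hR⟩ := R.uniformly_bounded
  refine ⟨|ν r|, fun f => R.seminorm_le fun ρ hρ => ?_⟩
  rw [CovariantRep.integratedForm_iG]
  exact (norm_mul_le _ _).trans (mul_le_mul (((hR ρ hρ).2 r).trans (le_abs_self _))
    (R.le_seminorm hρ f) (norm_nonneg _) (abs_nonneg _))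

end UniformlyBoundedClass

end IntegratedForm

/-! ### Completion of a seminormed algebra -/

section Completion

open UniformSpace

variable (𝕜 : Type*) [RCLike 𝕜]

theorem norm_completion_apply_le {E F : Type*} [SeminormedAddCommGroup E] [NormedSpace 𝕜 E]
    [SeminormedAddCommGroup F] [NormedSpace 𝕜 F] (L : E →L[𝕜] F) {C : ℝ}
    (hC : ∀ x, ‖L x‖ ≤ C * ‖x‖) (x : Completion E) : ‖L.completion x‖ ≤ C * ‖x‖ := by
  induction x using Completion.induction_on with
  | hp => exact isClosed_le (by fun_prop) (by fun_prop)
  | ih x => simpa using hC x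

theorem norm_fromCompletion_apply_le {E F : Type*} [SeminormedAddCommGroup E] [NormedSpace 𝕜 E]
    [NormedAddCommGroup F] [NormedSpace 𝕜 F] [CompleteSpace F] (L : E →L[𝕜] F) {C : ℝ}
    (hC : ∀ x, ‖L x‖ ≤ C * ‖x‖) (x : Completion E) : ‖L.fromCompletion x‖ ≤ C * ‖x‖ := by
  induction x using Completion.induction_on with
  | hp => exact isClosed_le (by fun_prop) (by fun_prop)
  | ih x => simpa using hC x

variable {𝕜} {E F : Type*} [SeminormedAddCommGroup E] [NormedSpace 𝕜 E]
  [NormedAddCommGroup F] [NormedSpace 𝕜 F]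

theorem completion_clm_ext {P Q : Completion E →L[𝕜] F} (h : ∀ x : E, P x = Q x) : P = Q :=
  DFunLike.coe_injective (Completion.ext P.continuous Q.continuous h)

variable (B : E →ₗ[𝕜] E →ₗ[𝕜] E) (hB : ∀ a b, ‖B a b‖ ≤ 1 * ‖a‖ * ‖b‖)

/-- The extension of `B a` to the completion. -/
noncomputable def completionLeft : E →ₗ[𝕜] (Completion E →L[𝕜] Completion E) where
  toFun a := (B.mkContinuous₂ 1 hB a).completion
  map_add' a b := completion_clm_ext fun x => by
    simp only [_root_.add_apply, ContinuousLinearMap.completion_apply_coe, map_add,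
      Completion.coe_add]
  map_smul' c a := completion_clm_ext fun x => by
    simp only [_root_.smul_apply, ContinuousLinearMap.completion_apply_coe, map_smul,
      Completion.coe_smul, RingHom.id_apply]

theorem norm_completionLeft_le (a : E) : ‖completionLeft B hB a‖ ≤ 1 * ‖a‖ := by
  rw [one_mul]
  refine ContinuousLinearMap.opNorm_le_bound _ (norm_nonneg a)
    (norm_completion_apply_le 𝕜 (B.mkContinuous₂ 1 hB a) (fun x => ?_))
  simpa using hB a x

/-- The continuous extension of a contractive bilinear product on a seminormed space to the
(Hausdorff) completion. -/
noncomputable def completionMul : Completion E →L[𝕜] Completion E →L[𝕜] Completion E :=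
  ((completionLeft B hB).mkContinuous 1 (norm_completionLeft_le B hB)).fromCompletion

theorem completionMul_coe (a b : E) :
    completionMul B hB (a : Completion E) (b : Completion E) = ((B a b : E) : Completion E) := by
  rw [completionMul, ContinuousLinearMap.fromCompletion_apply_coe]
  exact ContinuousLinearMap.completion_apply_coe (B.mkContinuous₂ 1 hB a) b

theorem completionMul_assoc (hB' : ∀ a b c, B (B a b) c = B a (B b c)) (x y z : Completion E) :
    completionMul B hB (completionMul B hB x y) z =
      completionMul B hB x (completionMul B hB y z) := by
  induction x, y, z using Completion.induction_on₃ with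
  | hp => exact isClosed_eq (by fun_prop) (by fun_prop)
  | ih x y z => simp only [completionMul_coe, hB']

theorem norm_completionMul_le (x y : Completion E) :
    ‖completionMul B hB x y‖ ≤ ‖x‖ * ‖y‖ := by
  induction x, y using Completion.induction_on₂ with
  | hp => exact isClosed_le (by fun_prop) (by fun_prop)
  | ih x y => simpa only [completionMul_coe, Completion.norm_coe, one_mul] using hB x y

end Completion

/-! ### The crossed product -/

section CrossedProduct

variable {𝕜 : Type*} [RCLike 𝕜]
  {A : Type*} [NonUnitalNormedRing A] [NormedSpace 𝕜 A]
  [IsScalarTower 𝕜 A A] [SMulCommClass 𝕜 A A] [CompleteSpace A]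
  {G : Type*} [Group G] [TopologicalSpace G] [IsTopologicalGroup G] [LocallyCompactSpace G]
  [T2Space G] [MeasurableSpace G] [BorelSpace G]
  {S : DynamicalSystem 𝕜 A G}

/-- The algebra `C_c(G, A)`, equipped with the seminorm `σ^R`. -/
def SeminormedConvAlg (_R : UniformlyBoundedClass.{w} S) (μ : Measure G) : Type _ := ConvAlg S μ

variable (R : UniformlyBoundedClass.{w} S) (μ : Measure G) [μ.IsHaarMeasure]

namespace SeminormedConvAlg

noncomputable instance : SeminormedAddCommGroup (SeminormedConvAlg R μ) :=
  AddGroupSeminorm.toSeminormedAddCommGroup (E := ConvAlg S μ)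
    { toFun := fun f => R.seminorm μ f
      map_zero' := R.seminorm_zero
      add_le' := R.seminorm_add_le
      neg' := R.seminorm_neg }

noncomputable instance : Module 𝕜 (SeminormedConvAlg R μ) :=
  inferInstanceAs (Module 𝕜 (ConvAlg S μ))

noncomputable instance : NormedSpace 𝕜 (SeminormedConvAlg R μ) where
  norm_smul_le := R.seminorm_smul_le

/-- Twisted convolution as a bilinear map. -/
noncomputable def mulₗ :
    SeminormedConvAlg R μ →ₗ[𝕜] SeminormedConvAlg R μ →ₗ[𝕜] SeminormedConvAlg R μ :=
  LinearMap.mul 𝕜 (ConvAlg S μ)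

theorem norm_mulₗ_le (f g : SeminormedConvAlg R μ) : ‖mulₗ R μ f g‖ ≤ 1 * ‖f‖ * ‖g‖ := by
  rw [one_mul]; exact R.seminorm_mul_le f g

theorem mulₗ_assoc (f g h : SeminormedConvAlg R μ) :
    mulₗ R μ (mulₗ R μ f g) h = mulₗ R μ f (mulₗ R μ g h) :=
  mul_assoc (G := ConvAlg S μ) f g h

end SeminormedConvAlg

/-- The crossed product `(A ⋊_α G)^R`: the Hausdorff completion of `C_c(G, A)` with respect to the
seminorm `σ^R`, i.e. the completion of the normed space `C_c(G, A) / ker σ^R`. -/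
def CrossedProduct : Type _ := UniformSpace.Completion (SeminormedConvAlg R μ)

namespace CrossedProduct

noncomputable instance : NormedAddCommGroup (CrossedProduct R μ) :=
  inferInstanceAs (NormedAddCommGroup (UniformSpace.Completion (SeminormedConvAlg R μ)))
noncomputable instance : NormedSpace 𝕜 (CrossedProduct R μ) :=
  inferInstanceAs (NormedSpace 𝕜 (UniformSpace.Completion (SeminormedConvAlg R μ)))
instance : CompleteSpace (CrossedProduct R μ) :=
  inferInstanceAs (CompleteSpace (UniformSpace.Completion (SeminormedConvAlg R μ)))

/-- The product of `(A ⋊_α G)^R`, determined by `q^R f * q^R g = q^R (f * g)`. -/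
noncomputable def mulL :
    CrossedProduct R μ →L[𝕜] CrossedProduct R μ →L[𝕜] CrossedProduct R μ :=
  completionMul (SeminormedConvAlg.mulₗ R μ) (SeminormedConvAlg.norm_mulₗ_le R μ)

/-- The crossed product is a Banach algebra. -/
noncomputable instance : NonUnitalNormedRing (CrossedProduct R μ) where
  __ := (inferInstance : NormedAddCommGroup (CrossedProduct R μ))
  mul x y := mulL R μ x y
  left_distrib x y z := map_add (mulL R μ x) y z
  right_distrib x y z := (mulL R μ).map_add₂ x y z
  zero_mul x := (mulL R μ).map_zero₂ x
  mul_zero x := map_zero (mulL R μ x)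
  mul_assoc x y z := completionMul_assoc (SeminormedConvAlg.mulₗ R μ)
    (SeminormedConvAlg.norm_mulₗ_le R μ) (SeminormedConvAlg.mulₗ_assoc R μ) x y z
  norm_mul_le x y := norm_completionMul_le (SeminormedConvAlg.mulₗ R μ)
    (SeminormedConvAlg.norm_mulₗ_le R μ) x y

noncomputable instance : NormedSpace 𝕜 (CrossedProduct R μ) :=
  inferInstanceAs (NormedSpace 𝕜 (UniformSpace.Completion (SeminormedConvAlg R μ)))

instance : IsScalarTower 𝕜 (CrossedProduct R μ) (CrossedProduct R μ) :=
  ⟨fun c x y => (mulL R μ).map_smul₂ c x y⟩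
instance : SMulCommClass 𝕜 (CrossedProduct R μ) (CrossedProduct R μ) :=
  ⟨fun c x y => (map_smul (mulL R μ x) c y).symm⟩

variable {R μ}

/-- The canonical map `q^R : C_c(G, A) → (A ⋊_α G)^R`. -/
noncomputable def q (f : ConvAlg S μ) : CrossedProduct R μ :=
  UniformSpace.Completion.coe' (α := SeminormedConvAlg R μ) f

theorem norm_q (f : ConvAlg S μ) : ‖(q f : CrossedProduct R μ)‖ = R.seminorm μ f :=
  UniformSpace.Completion.norm_coe (E := SeminormedConvAlg R μ) f

theorem q_add (f g : ConvAlg S μ) : (q (f + g) : CrossedProduct R μ) = q f + q g :=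
  UniformSpace.Completion.coe_add (α := SeminormedConvAlg R μ) f g

theorem q_smul (c : 𝕜) (f : ConvAlg S μ) : (q (c • f) : CrossedProduct R μ) = c • q f :=
  UniformSpace.Completion.coe_smul (X := SeminormedConvAlg R μ) c f

theorem q_mul (f g : ConvAlg S μ) : (q (f * g) : CrossedProduct R μ) = q f * q g :=
  (completionMul_coe (SeminormedConvAlg.mulₗ R μ) (SeminormedConvAlg.norm_mulₗ_le R μ) f g).symm

theorem denseRange_q : DenseRange (q : ConvAlg S μ → CrossedProduct R μ) :=
  UniformSpace.Completion.denseRange_coe (α := SeminormedConvAlg R μ)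

theorem ext_of_q {X : Type*} [TopologicalSpace X] [T2Space X] {F H : CrossedProduct R μ → X}
    (hF : Continuous F) (hH : Continuous H) (h : ∀ f : ConvAlg S μ, F (q f) = H (q f)) : F = H :=
  denseRange_q.equalizer hF hH (funext h)

/-- A `σ^R`-bounded linear map on `C_c(G, A)`, as a bounded operator. -/
noncomputable def toCLM {E : Type*} [NormedAddCommGroup E] [NormedSpace 𝕜 E]
    (T : ConvAlg S μ →ₗ[𝕜] E) (hT : ∃ C : ℝ, ∀ f, ‖T f‖ ≤ C * R.seminorm μ f) :
    SeminormedConvAlg R μ →L[𝕜] E :=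
  LinearMap.mkContinuousOfExistsBound (E := SeminormedConvAlg R μ) T hT

/-- The bounded operator `T^R : (A ⋊_α G)^R → E`, determined by `T^R (q^R f) = T f`, associated to a
`σ^R`-bounded linear map `T : C_c(G, A) → E` into a Banach space. -/
noncomputable def lift {E : Type*} [NormedAddCommGroup E] [NormedSpace 𝕜 E] [CompleteSpace E]
    (T : ConvAlg S μ →ₗ[𝕜] E) (hT : ∃ C : ℝ, ∀ f, ‖T f‖ ≤ C * R.seminorm μ f) :
    CrossedProduct R μ →L[𝕜] E :=
  (toCLM T hT).fromCompletion

theorem lift_q {E : Type*} [NormedAddCommGroup E] [NormedSpace 𝕜 E] [CompleteSpace E]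
    (T : ConvAlg S μ →ₗ[𝕜] E) (hT : ∃ C : ℝ, ∀ f, ‖T f‖ ≤ C * R.seminorm μ f) (f : ConvAlg S μ) :
    lift (R := R) T hT (q f) = T f :=
  ContinuousLinearMap.fromCompletion_apply_coe (toCLM (R := R) T hT) f

theorem norm_lift_apply_le {E : Type*} [NormedAddCommGroup E] [NormedSpace 𝕜 E] [CompleteSpace E]
    (T : ConvAlg S μ →ₗ[𝕜] E) {C : ℝ} (hT : ∀ f, ‖T f‖ ≤ C * R.seminorm μ f)
    (x : CrossedProduct R μ) : ‖lift T ⟨C, hT⟩ x‖ ≤ C * ‖x‖ :=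
  norm_fromCompletion_apply_le 𝕜 (toCLM T ⟨C, hT⟩) hT x

/-- `f ↦ q^R (i_A(a) f)` -/
noncomputable def qIA (a : A) : ConvAlg S μ →ₗ[𝕜] CrossedProduct R μ where
  toFun f := q (f.iA a)
  map_add' f g := by
    rw [← q_add]; congr 1; ext s; simp [mul_add]
  map_smul' c f := by
    rw [RingHom.id_apply, ← q_smul]; congr 1; ext s; simp [mul_smul_comm]

/-- `f ↦ q^R (i_G(r) f)` -/
noncomputable def qIG (r : G) : ConvAlg S μ →ₗ[𝕜] CrossedProduct R μ where
  toFun f := q (f.iG r)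
  map_add' f g := by
    rw [← q_add]; congr 1; ext s; simp
  map_smul' c f := by
    rw [RingHom.id_apply, ← q_smul]; congr 1; ext s; simp

theorem qIA_bound (a : A) :
    ∃ C : ℝ, ∀ f : ConvAlg S μ, ‖(qIA a f : CrossedProduct R μ)‖ ≤ C * R.seminorm μ f := by
  obtain ⟨C, -, hC⟩ := R.exists_seminorm_iA_le (μ := μ)
  exact ⟨C * ‖a‖, fun f => (norm_q _).trans_le (hC a f)⟩

theorem qIG_bound (r : G) :
    ∃ C : ℝ, ∀ f : ConvAlg S μ, ‖(qIG r f : CrossedProduct R μ)‖ ≤ C * R.seminorm μ f := by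
  obtain ⟨C, hC⟩ := R.exists_seminorm_iG_le (μ := μ) r
  exact ⟨C, fun f => (norm_q _).trans_le (hC f)⟩

/-- The operator `i_A^R(a)` on `(A ⋊_α G)^R`, determined by `i_A^R(a) (q^R f) = q^R (i_A(a) f)`. -/
noncomputable def opA (a : A) : CrossedProduct R μ →L[𝕜] CrossedProduct R μ :=
  lift (qIA a) (qIA_bound a)

/-- The operator `i_G^R(r)` on `(A ⋊_α G)^R`, determined by `i_G^R(r) (q^R f) = q^R (i_G(r) f)`. -/
noncomputable def opG (r : G) : CrossedProduct R μ →L[𝕜] CrossedProduct R μ :=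
  lift (qIG r) (qIG_bound r)

theorem opA_q (a : A) (f : ConvAlg S μ) : opA a (q f : CrossedProduct R μ) = q (f.iA a) :=
  lift_q _ _ f

theorem opG_q (r : G) (f : ConvAlg S μ) : opG r (q f : CrossedProduct R μ) = q (f.iG r) :=
  lift_q _ _ f

theorem op_ext {P Q : CrossedProduct R μ →L[𝕜] CrossedProduct R μ}
    (h : ∀ f : ConvAlg S μ, P (q f) = Q (q f)) : P = Q :=
  DFunLike.coe_injective (ext_of_q P.continuous Q.continuous h)

variable (R μ)

/-- The canonical covariant representation `(i_A^R, i_G^R)` of `(A, G, α)` on `(A ⋊_α G)^R`. -/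
noncomputable def canonicalRep : CovariantRep S (CrossedProduct R μ) where
  π :=
    { toFun := opA
      map_smul' := fun c a => op_ext fun f => by
        simp only [MonoidHom.id_apply, _root_.smul_apply, opA_q, ← q_smul]
        congr 1; ext s; simp [smul_mul_assoc]
      map_zero' := op_ext fun f => by
        have : f.iA 0 = (0 : 𝕜) • f := by ext s; simp
        rw [opA_q, this, q_smul, zero_smul]; rfl
      map_add' := fun a b => op_ext fun f => by
        simp only [_root_.add_apply, opA_q, ← q_add]
        congr 1; ext s; simp [add_mul]
      map_mul' := fun a b => op_ext fun f => by
        simp only [mul_apply_eq_comp, opA_q]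
        congr 1; ext s; simp [mul_assoc] }
  U :=
    { toFun := opG
      map_one' := op_ext fun f => by
        rw [opG_q]
        change q (f.iG 1) = q f
        congr 1; ext s; simp
      map_mul' := fun r t => op_ext fun f => by
        simp only [mul_apply_eq_comp, opG_q]
        congr 1; ext s
        simp only [ConvAlg.iG_apply, ConvAlg.α_mul_apply, mul_inv_rev, mul_assoc] }
  covariant a r := op_ext fun f => by
    change opA (S.α r a) (q f) = opG r (opA a (opG r⁻¹ (q f)))
    simp only [opA_q, opG_q]
    congr 1; ext s
    simp only [ConvAlg.iG_apply, ConvAlg.iA_apply, S.map_mul, ← ConvAlg.α_mul_apply,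
      mul_inv_cancel, map_one, inv_inv, mul_inv_cancel_left]
    rfl

end CrossedProduct

/-! ### `R`-continuous covariant representations -/

namespace CovariantRep

variable {X : Type*} [NormedAddCommGroup X] [NormedSpace 𝕜 X] [CompleteSpace X]
  (ρ : CovariantRep S X)

/-- A covariant representation `(π, U)` is `R`-continuous if it is continuous and the homomorphism
`π ⋊ U : C_c(G, A) → B(X)` is `σ^R`-bounded. -/
def IsRContinuous : Prop :=
  ∃ h : ρ.IsContinuous, ∃ C : ℝ, ∀ f : ConvAlg S μ, ‖integratedForm μ h f‖ ≤ C * R.seminorm μ f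

variable {ρ R μ}

/-- The bounded representation `(π ⋊ U)^R` of `(A ⋊_α G)^R` on `X` associated to an `R`-continuous
covariant representation `(π, U)`, determined by `(π ⋊ U)^R (q^R f) = π ⋊ U (f)`. -/
noncomputable def integratedFormR (h : ρ.IsRContinuous R μ) :
    CrossedProduct R μ →ₙₐ[𝕜] (X →L[𝕜] X) :=
  let T : CrossedProduct R μ →L[𝕜] (X →L[𝕜] X) :=
    CrossedProduct.lift ((integratedForm μ h.choose : ConvAlg S μ →ₙₐ[𝕜] (X →L[𝕜] X)) :
      ConvAlg S μ →ₗ[𝕜] (X →L[𝕜] X)) h.choose_spec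
  { T with
    map_zero' := map_zero T
    map_mul' := fun x y => by
      change T (x * y) = T x * T y
      have hc : Continuous fun p : CrossedProduct R μ × CrossedProduct R μ => T (p.1 * p.2) := by
        fun_prop
      have hc' : Continuous fun p : CrossedProduct R μ × CrossedProduct R μ => T p.1 * T p.2 := by
        fun_prop
      have hd : DenseRange (Prod.map (CrossedProduct.q : ConvAlg S μ → CrossedProduct R μ)
          (CrossedProduct.q : ConvAlg S μ → CrossedProduct R μ)) :=
        CrossedProduct.denseRange_q.prodMap CrossedProduct.denseRange_q
      refine congrFun (hd.equalizer hc hc' (funext fun p => ?_)) (x, y)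
      have hT : ∀ f : ConvAlg S μ, T (CrossedProduct.q f) = integratedForm μ h.choose f :=
        fun f => CrossedProduct.lift_q _ _ f
      simp only [Function.comp_apply, Prod.map_fst, Prod.map_snd, ← CrossedProduct.q_mul, hT]
      exact map_mul (integratedForm μ h.choose) p.1 p.2 }

theorem integratedFormR_q (h : ρ.IsRContinuous R μ) (f : ConvAlg S μ) :
    integratedFormR h (CrossedProduct.q f) = integratedForm μ h.choose f :=
  CrossedProduct.lift_q _ _ f

end CovariantRep

end CrossedProduct

end BanachCrossedProduct

namespace BanachCrossedProduct

open MeasureTheory Filter Topology Set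
open scoped CompactlySupported Pointwise

/-! Write `Φ = (π ⋊ U)^R` for the extension to the crossed product of the integrated form of a
member `(π, U)` of `R` (`liftRep`). The central step is that `i_A^R ⋊ i_G^R (f)` is left
multiplication by `q f`. It is proved inside the representations of `R`: each `Φ` satisfies
`Φ(i_A^R(a) x) = π(a) Φ(x)` and `Φ(i_G^R(r) x) = U_r Φ(x)` (`liftRep_opA`, `liftRep_opG`), and
together the `Φ` separate points, because the norm of `q f` is the supremum of the `‖Φ(q f)‖`
(`eq_of_liftRep_eq`). Applying `Φ` to `∫ i_A^R(f(s)) i_G^R(s) q(g) ds` gives `π ⋊ U (f) (π ⋊ U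
(g))`, which is also `Φ(q(f * g))`; hence the integral is `q f * q g`
(`integratedForm_canonicalRep`). Submultiplicativity of the norm then yields `R`-continuity with
constant 1, and density of the range of `q` identifies the extended representation with the left
regular one.

The integral makes sense only once `(i_A^R, i_G^R)` is continuous. Boundedness of `i_A^R` is
inherited from the uniform bound on `R`. For `i_G^R`, local boundedness reduces strong continuity to
the vectors `q f`, and there it follows from `tendsto_q`: on functions supported in a fixed compact
set, `σ^R` is dominated by the sup norm.

Non-degeneracy of `i_A^R` holds because a bounded left approximate identity acts as a limit identity
uniformly on the compact set `f(supp f)` (`q_mem_closure_span`). It passes to integrated forms by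
testing on functions `φ ⊗ a` with `φ` a bump near the identity of `G`: after normalisation, `π ⋊ U
(φ ⊗ a) x` is close to `π(a) x` (`π_apply_mem_closure_span`). -/

/-- Pointwise convergence of an eventually bounded family of operators extends from a dense range
to the whole space. -/
theorem tendsto_clm_apply_of_denseRange {𝕜 : Type*} [RCLike 𝕜] {E F : Type*}
    [NormedAddCommGroup E] [NormedSpace 𝕜 E] [NormedAddCommGroup F] [NormedSpace 𝕜 F]
    {ι D : Type*} {l : Filter ι} {T : ι → E →L[𝕜] F} {T₀ : E →L[𝕜] F} {e : D → E}
    (he : DenseRange e) {N : ℝ} (hN : ∀ᶠ i in l, ∀ x, ‖T i x‖ ≤ N * ‖x‖)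
    (h : ∀ d, Tendsto (fun i => T i (e d)) l (𝓝 (T₀ (e d)))) (x : E) :
    Tendsto (fun i => T i x) l (𝓝 (T₀ x)) := by
  rw [Metric.tendsto_nhds]
  intro ε hε
  -- The error is at most `(|N| + ‖T₀‖) ‖x - e d‖` plus the error at `e d`, each kept below `ε / 2`.
  -- The absolute value allows for a negative `N`, and the summand 1 keeps the divisor positive.
  have hpos : 0 < |N| + ‖T₀‖ + 1 := by positivity
  obtain ⟨d, hd⟩ := he.exists_dist_lt x (div_pos (half_pos hε) hpos)
  rw [dist_eq_norm, lt_div_iff₀ hpos] at hd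
  filter_upwards [hN, Metric.tendsto_nhds.1 (h d) (ε / 2) (half_pos hε)] with i hi hi'
  rw [dist_eq_norm] at hi' ⊢
  have h1 : ‖T i (x - e d)‖ ≤ |N| * ‖x - e d‖ :=
    (hi _).trans (mul_le_mul_of_nonneg_right (le_abs_self N) (norm_nonneg _))
  have h2 : ‖T₀ (x - e d)‖ ≤ ‖T₀‖ * ‖x - e d‖ := T₀.le_opNorm _
  have h3 : T i x - T₀ x = T i (x - e d) + (T i (e d) - T₀ (e d)) - T₀ (x - e d) := by
    rw [map_sub, map_sub]; abel
  calc ‖T i x - T₀ x‖ ≤ ‖T i (x - e d)‖ + ‖T i (e d) - T₀ (e d)‖ + ‖T₀ (x - e d)‖ := by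
        rw [h3]
        exact (norm_sub_le _ _).trans (add_le_add_left (norm_add_le _ _) _)
    _ < ε := by nlinarith [norm_nonneg (x - e d)]

/-! ### Averages of vector-valued functions against bump functions -/

section Averaging

variable (𝕜 : Type*) [RCLike 𝕜] {G : Type*} [TopologicalSpace G] [MeasurableSpace G]
  [OpensMeasurableSpace G] {X : Type*} [NormedAddCommGroup X] [NormedSpace 𝕜 X] [CompleteSpace X]
  {μ : Measure G} [IsFiniteMeasureOnCompacts μ]

/-- Averaging against a nonnegative weight changes a vector at most by the oscillation on the
support of the weight. -/
theorem norm_integral_smul_sub_le {φ : G → ℝ} (hφ : Continuous φ) (hφ' : HasCompactSupport φ)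
    (hφ₀ : ∀ s, 0 ≤ φ s) {ψ : G → X} (hψ : Continuous ψ) (y : X) {ε : ℝ}
    (h : ∀ s, φ s ≠ 0 → ‖ψ s - y‖ ≤ ε) :
    ‖integral 𝕜 μ (fun s => (φ s : 𝕜) • ψ s) - ((∫ s, φ s ∂μ : ℝ) : 𝕜) • y‖ ≤
      (∫ s, φ s ∂μ) * ε := by
  letI : NormedSpace ℝ X := NormedSpace.restrictScalars ℝ 𝕜 X
  have : IsScalarTower ℝ 𝕜 X := RestrictScalars.isScalarTower ℝ 𝕜 X
  have hint : Integrable φ μ := hφ.integrable_of_hasCompactSupport hφ'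
  have h1 : Integrable (fun s => φ s • ψ s) μ :=
    (hφ.smul hψ).integrable_of_hasCompactSupport hφ'.smul_right
  have h2 : Integrable (fun s => φ s • y) μ := hint.smul_const y
  have e1 : integral 𝕜 μ (fun s => (φ s : 𝕜) • ψ s) = ∫ s, φ s • ψ s ∂μ := by
    change ∫ s, (φ s : 𝕜) • ψ s ∂μ = _
    simp only [RCLike.real_smul_eq_coe_smul (K := 𝕜)]
  have e2 : ((∫ s, φ s ∂μ : ℝ) : 𝕜) • y = ∫ s, φ s • y ∂μ := by
    rw [integral_smul_const, RCLike.real_smul_eq_coe_smul (K := 𝕜)]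
  rw [e1, e2, ← MeasureTheory.integral_sub h1 h2, ← MeasureTheory.integral_mul_const]
  refine norm_integral_le_of_norm_le (hint.mul_const ε) (Eventually.of_forall fun s => ?_)
  rw [← smul_sub, norm_smul, Real.norm_of_nonneg (hφ₀ s)]
  -- The oscillation bound `h` is available only where `φ` is nonzero; elsewhere both sides vanish.
  by_cases hs : φ s = 0
  · simp [hs]
  · exact mul_le_mul_of_nonneg_left (h s hs) (hφ₀ s)

end Averaging

section Bump

variable {G : Type*} [TopologicalSpace G] [LocallyCompactSpace G] [T2Space G]
  [MeasurableSpace G] [BorelSpace G]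

/-- Urysohn's lemma separates `g` from the complement of the interior of `V`. The integral is
positive since `φ g = 1` and nonempty open sets have positive measure. Normalisation is left to the
use site. -/
theorem exists_bump_integral_pos (μ : Measure G) [μ.IsOpenPosMeasure]
    [IsFiniteMeasureOnCompacts μ] {g : G} {V : Set G} (hV : V ∈ 𝓝 g) :
    ∃ φ : G → ℝ, Continuous φ ∧ HasCompactSupport φ ∧ (∀ s, 0 ≤ φ s) ∧ (∀ s, φ s ≠ 0 → s ∈ V) ∧
      0 < ∫ s, φ s ∂μ := by
  obtain ⟨φ, h1, h0, hc, hI⟩ := exists_continuous_one_zero_of_isCompact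
    (isCompact_singleton (x := g)) (isOpen_interior (s := V)).isClosed_compl
    (disjoint_compl_right_iff_subset.2 (singleton_subset_iff.2 (mem_interior_iff_mem_nhds.2 hV)))
  refine ⟨φ, φ.continuous, hc, fun s => (hI s).1, fun s hs => ?_,
    φ.continuous.integral_pos_of_hasCompactSupport_nonneg_nonzero hc (fun s => (hI s).1)
      (x := g) ?_⟩
  · by_contra hsV
    exact hs (h0 fun hs' => hsV (interior_subset hs'))
  · rw [h1 (mem_singleton g)]; exact one_ne_zero

end Bump

section CrossedProduct

variable {𝕜 : Type*} [RCLike 𝕜]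
  {A : Type*} [NonUnitalNormedRing A] [NormedSpace 𝕜 A]
  [IsScalarTower 𝕜 A A] [SMulCommClass 𝕜 A A] [CompleteSpace A]
  {G : Type*} [Group G] [TopologicalSpace G] [IsTopologicalGroup G] [LocallyCompactSpace G]
  [T2Space G] [MeasurableSpace G] [BorelSpace G]
  {S : DynamicalSystem 𝕜 A G} {μ : Measure G} [μ.IsHaarMeasure]

/-! ### Non-degeneracy passes to integrated forms -/

namespace CovariantRep

variable {X : Type*} [NormedAddCommGroup X] [NormedSpace 𝕜 X] [CompleteSpace X]
  {ρ : CovariantRep S X}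

/-- The vectors `π(a) x` are limits of vectors in the range of the integrated form. -/
theorem π_apply_mem_closure_span (h : ρ.IsContinuous) (a : A) (x : X) :
    ρ.π a x ∈ closure (Submodule.span 𝕜
      {y : X | ∃ (f : ConvAlg S μ) (x : X), integratedForm μ h f x = y} : Set X) := by
  rw [Metric.mem_closure_iff]
  intro ε hε
  have hψ : Continuous fun s => ρ.π a (ρ.U s x) :=
    continuous_π_U h continuous_const continuous_id continuous_const
  -- Half of `ε` is used because averaging preserves only the weak inequality, while membership in
  -- the closure needs a strict one.
  have hV : {s | ‖ρ.π a (ρ.U s x) - ρ.π a x‖ < ε / 2} ∈ 𝓝 (1 : G) := by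
    have hc := ((hψ.sub continuous_const).norm (f := fun s => ρ.π a (ρ.U s x) - ρ.π a x)).continuousAt (x := 1)
    exact hc.eventually_lt_const (by simpa using half_pos hε)
  obtain ⟨φ, hφ, hφc, hφ₀, hφV, hpos⟩ := exists_bump_integral_pos μ hV
  let f : ConvAlg S μ := ConvAlg.mk (fun s => (φ s : 𝕜) • a)
    ((RCLike.continuous_ofReal.comp hφ).smul continuous_const)
    (HasCompactSupport.intro hφc.isCompact fun s hs => by
      rw [image_eq_zero_of_notMem_tsupport hs, RCLike.ofReal_zero, zero_smul])
  have hle := norm_integral_smul_sub_le 𝕜 (μ := μ) hφ hφc hφ₀ hψ (ρ.π a x)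
    (fun s hs => (hφV s hs).le)
  have hf : integral 𝕜 μ (fun s => (φ s : 𝕜) • ρ.π a (ρ.U s x)) = integratedForm μ h f x := by
    rw [integratedForm_apply]
    congr 1; funext s
    simp only [f, ConvAlg.mk_apply, map_smul, _root_.smul_apply]
  rw [hf] at hle
  set I : ℝ := ∫ s, φ s ∂μ
  have hI : (I : 𝕜) ≠ 0 := RCLike.ofReal_ne_zero.2 hpos.ne'
  -- Dividing by `I` turns the weight `φ` into one of total mass 1.
  refine ⟨(I : 𝕜)⁻¹ • integratedForm μ h f x,
    Submodule.smul_mem _ _ (Submodule.subset_span ⟨f, x, rfl⟩), ?_⟩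
  have e : (I : 𝕜)⁻¹ • integratedForm μ h f x - ρ.π a x =
      (I : 𝕜)⁻¹ • (integratedForm μ h f x - (I : 𝕜) • ρ.π a x) := by
    rw [smul_sub, smul_smul, inv_mul_cancel₀ hI, one_smul]
  rw [dist_comm, dist_eq_norm, e, norm_smul, norm_inv, RCLike.norm_ofReal, abs_of_pos hpos,
    inv_mul_lt_iff₀ hpos]
  exact hle.trans_lt (mul_lt_mul_of_pos_left (half_lt_self hε) hpos)

/-- The integrated form of a non-degenerate continuous covariant representation is
non-degenerate. -/
theorem isNondegenerate_integratedForm (h : ρ.IsContinuous) (hπ : IsNondegenerate ρ.π) :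
    IsNondegenerate (integratedForm μ h) := by
  -- The closure of a subspace is a subspace, so only the generators `π(a) x` have to be
  -- approximated.
  have hle : Submodule.span 𝕜 {y : X | ∃ (a : A) (x : X), ρ.π a x = y} ≤
      (Submodule.span 𝕜
        {y : X | ∃ (f : ConvAlg S μ) (x : X), integratedForm μ h f x = y}).topologicalClosure := by
    refine Submodule.span_le.2 ?_
    rintro _ ⟨a, x, rfl⟩
    exact π_apply_mem_closure_span h a x
  exact dense_closure.1 (hπ.mono hle)

variable {R : UniformlyBoundedClass.{w} S}

theorem isNondegenerate_integratedFormR (h : ρ.IsRContinuous R μ) (hπ : IsNondegenerate ρ.π) :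
    IsNondegenerate (integratedFormR h) := by
  refine (isNondegenerate_integratedForm (μ := μ) h.choose hπ).mono (Submodule.span_mono ?_)
  rintro _ ⟨f, x, rfl⟩
  exact ⟨CrossedProduct.q f, x, by rw [integratedFormR_q]⟩

end CovariantRep

/-! ### Estimates for the seminorm that are uniform on compact sets -/

namespace UniformlyBoundedClass

variable (R : UniformlyBoundedClass.{w} S)

/-- On functions supported in a fixed compact set, `σ^R` is dominated by the sup norm. -/
theorem exists_seminorm_le_of_support {K : Set G} (hK : IsCompact K) :
    ∃ C : ℝ, 0 ≤ C ∧ ∀ (f : ConvAlg S μ) (M : ℝ), (∀ s, s ∉ K → f s = 0) → (∀ s, ‖f s‖ ≤ M) →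
      R.seminorm μ f ≤ C * M := by
  obtain ⟨C, ν, hν, hR⟩ := R.uniformly_bounded
  obtain ⟨N, hN⟩ := hν K hK
  refine ⟨|C| * |N| * μ.real K, by positivity, fun f M hf hM => R.seminorm_le fun ρ hρ => ?_⟩
  have hM₀ : 0 ≤ M := (norm_nonneg _).trans (hM 1)
  have hsub : tsupport f ⊆ K :=
    closure_minimal (fun s hs => by_contra fun h => hs (hf s h)) hK.isClosed
  have hμ : μ.real (tsupport f) ≤ μ.real K := measureReal_mono hsub hK.measure_lt_top.ne
  refine ContinuousLinearMap.opNorm_le_bound _ (by positivity) fun x => ?_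
  refine (CovariantRep.exists_norm_integral_le (hR ρ hρ).1 f hM
    (fun s hs => (hN (mem_image_of_mem ν (hsub hs))).trans (le_abs_self N))
    (fun s _ => (hR ρ hρ).2 s) x).trans (mul_le_mul_of_nonneg_right ?_ (norm_nonneg x))
  calc |C| * M * |N| * μ.real (tsupport f) ≤ |C| * M * |N| * μ.real K := by gcongr
    _ = |C| * |N| * μ.real K * M := by ring

/-- A single constant for all `r ∈ K`, which comes from boundedness of `ν` on `K`, is what the
density argument for strong continuity of `i_G^R` needs; a constant depending on `r` would not do.
-/
theorem exists_seminorm_iG_le_of_isCompact {K : Set G} (hK : IsCompact K) :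
    ∃ N : ℝ, ∀ r ∈ K, ∀ f : ConvAlg S μ, R.seminorm μ (f.iG r) ≤ N * R.seminorm μ f := by
  obtain ⟨C, ν, hν, hR⟩ := R.uniformly_bounded
  obtain ⟨N, hN⟩ := hν K hK
  refine ⟨|N|, fun r hr f => R.seminorm_le fun ρ hρ => ?_⟩
  rw [CovariantRep.integratedForm_iG]
  have hU : ‖ρ.rep.U r‖ ≤ |N| :=
    ((hR ρ hρ).2 r).trans ((hN (mem_image_of_mem ν hr)).trans (le_abs_self N))
  exact (norm_mul_le _ _).trans
    (mul_le_mul hU (R.le_seminorm hρ f) (norm_nonneg _) (abs_nonneg _))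

end UniformlyBoundedClass

/-! ### Continuity and non-degeneracy of the canonical covariant representation -/

namespace CrossedProduct

variable {R : UniformlyBoundedClass.{w} S}

theorem q_sub (f g : ConvAlg S μ) : (q (f - g) : CrossedProduct R μ) = q f - q g :=
  UniformSpace.Completion.coe_sub (α := SeminormedConvAlg R μ) f g

/-- `q^R` is continuous for uniform convergence with supports in a fixed compact set. -/
theorem tendsto_q {ι : Type*} {l : Filter ι} {F : ι → ConvAlg S μ} {f : ConvAlg S μ} {K : Set G}
    (hK : IsCompact K) (hF : ∀ᶠ i in l, ∀ s, s ∉ K → F i s = 0) (hf : ∀ s, s ∉ K → f s = 0)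
    (h : ∀ ε > 0, ∀ᶠ i in l, ∀ s ∈ K, ‖F i s - f s‖ < ε) :
    Tendsto (fun i => (q (F i) : CrossedProduct R μ)) l (𝓝 (q f)) := by
  obtain ⟨C, hC₀, hC⟩ := R.exists_seminorm_le_of_support (μ := μ) hK
  rw [Metric.tendsto_nhds]
  intro ε hε
  -- With tolerance `ε / (C + 1)` the bound `C * ε / (C + 1)` is strictly below `ε`, also when `C =
  -- 0`.
  have hpos : 0 < C + 1 := by positivity
  filter_upwards [hF, h (ε / (C + 1)) (div_pos hε hpos)] with i hi hi'
  have hs : ∀ s, (F i - f) s = F i s - f s := fun s => rfl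
  rw [dist_eq_norm, ← q_sub, norm_q]
  refine (hC (F i - f) (ε / (C + 1)) (fun s hs' => ?_) (fun s => ?_)).trans_lt ?_
  · rw [hs, hi s hs', hf s hs', sub_zero]
  · by_cases hsK : s ∈ K
    · exact (hi' s hsK).le
    · rw [hs, hi s hsK, hf s hsK, sub_zero, norm_zero]; positivity
  · rw [mul_div_assoc', div_lt_iff₀ hpos]
    linarith

/-- For `r` in a compact neighbourhood `K` of `r₀`, all functions `i_G(r) f` vanish off the compact
set `K * tsupport f`, so uniform convergence there suffices. -/
theorem tendsto_q_iG (f : ConvAlg S μ) (r₀ : G) :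
    Tendsto (fun r => (q (f.iG r) : CrossedProduct R μ)) (𝓝 r₀) (𝓝 (q (f.iG r₀))) := by
  obtain ⟨K, hK, hKr⟩ := exists_compact_mem_nhds r₀
  have hsupp : ∀ r ∈ K, ∀ s, s ∉ K * tsupport f → f.iG r s = 0 := fun r hr s hs => by
    have : r⁻¹ * s ∉ tsupport f := fun h => hs ⟨r, hr, r⁻¹ * s, h, by simp⟩
    rw [ConvAlg.iG_apply, f.eq_zero_of_notMem this, map_zero]
  have hKf : IsCompact (K * tsupport f) := hK.mul f.hasCompactSupport.isCompact
  refine tendsto_q hKf (eventually_of_mem hKr hsupp) (hsupp r₀ (mem_of_mem_nhds hKr))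
    -- Compactness gives uniformity in `s`: it is enough that the difference, jointly continuous in
    -- `(r, s)`, is small near each point `(r₀, s)`, where it vanishes.
    fun ε hε => hKf.eventually_forall_of_forall_eventually fun s _ => ?_
  have hc : Continuous fun p : G × G => ‖S.α p.1 (f (p.1⁻¹ * p.2)) - S.α r₀ (f (r₀⁻¹ * p.2))‖ :=
    ((ConvAlg.continuous_act continuous_fst (f.continuous.comp (by fun_prop))).sub
      (ConvAlg.continuous_act continuous_const (f.continuous.comp (by fun_prop)))).norm
  exact hc.continuousAt.eventually_lt_const (by simpa using hε)

/-- Near `r₀` the operators `i_G^R(r)` share a norm bound, so convergence on the dense range of `q`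
is enough. -/
theorem continuous_opG_apply (x : CrossedProduct R μ) : Continuous fun r => opG r x := by
  rw [continuous_iff_continuousAt]
  intro r₀
  obtain ⟨K, hK, hKr⟩ := exists_compact_mem_nhds r₀
  obtain ⟨N, hN⟩ := R.exists_seminorm_iG_le_of_isCompact (μ := μ) hK
  refine tendsto_clm_apply_of_denseRange (N := N) denseRange_q
    (eventually_of_mem hKr fun r hr => ?_) (fun f => ?_) x
  -- The extension does not depend on the constant witnessing its boundedness, so `opG r` inherits
  -- the local constant `N`.
  · exact norm_lift_apply_le (qIG r) (fun f => (norm_q _).trans_le (hN r hr f))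
  · simp only [opG_q]
    exact tendsto_q_iG f r₀

variable (μ R) in
theorem canonicalRep_isContinuous : (canonicalRep R μ).IsContinuous where
  bounded := by
    obtain ⟨C, hC₀, hC⟩ := R.exists_seminorm_iA_le (μ := μ)
    refine ⟨C, fun a => ContinuousLinearMap.opNorm_le_bound _ (by positivity) ?_⟩
    exact norm_lift_apply_le (qIA a) (fun f => (norm_q _).trans_le (hC a f))
  strongly_continuous := continuous_opG_apply

/-- If `A` has a bounded left approximate identity, then every `q^R(f)` is a limit of elements
`i_A^R(u) q^R(f)`. -/
theorem q_mem_closure_span (hA : HasBoundedLeftApproximateIdentity A) (f : ConvAlg S μ) :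
    (q f : CrossedProduct R μ) ∈ closure (Submodule.span 𝕜
      {y | ∃ (a : A) (x : CrossedProduct R μ), (canonicalRep R μ).π a x = y} :
        Set (CrossedProduct R μ)) := by
  obtain ⟨l, hl, ⟨M, hM⟩, hu⟩ := hA
  have ht : Tendsto (fun u => (q (f.iA u) : CrossedProduct R μ)) l (𝓝 (q f)) := by
    refine tendsto_q f.hasCompactSupport.isCompact
      (Eventually.of_forall fun u s hs => by
        rw [ConvAlg.iA_apply, f.eq_zero_of_notMem hs, mul_zero])
      (fun s hs => f.eq_zero_of_notMem hs) fun ε hε => ?_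
    -- The three-term estimate below costs `|M| + 1` times the distance from `f s` to a centre `b`,
    -- plus one term `‖u * b - b‖`.
    have hpos : 0 < |M| + 2 := by positivity
    have hδ : 0 < ε / (|M| + 2) := div_pos hε hpos
    -- Since the approximate identity is bounded, convergence at finitely many centres `b` controls
    -- it on the whole compact set `f(supp f)`.
    obtain ⟨t, -, htf, hcov⟩ := (f.hasCompactSupport.isCompact.image f.continuous).finite_cover_balls
      hδ
    filter_upwards [hM, (eventually_all_finite htf).2 fun b _ =>
      Metric.tendsto_nhds.1 (hu b) _ hδ] with u huM hut s hs
    obtain ⟨b, hb, hsb⟩ := mem_iUnion₂.1 (hcov (mem_image_of_mem f hs))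
    have hb' := hut b hb
    rw [Metric.mem_ball, dist_eq_norm, lt_div_iff₀ hpos] at hsb
    rw [dist_eq_norm, lt_div_iff₀ hpos] at hb'
    have e : u * f s - f s = u * (f s - b) + (u * b - b) - (f s - b) := by
      rw [mul_sub]; abel
    have h1 : ‖u * (f s - b)‖ ≤ |M| * ‖f s - b‖ :=
      (norm_mul_le _ _).trans
        (mul_le_mul_of_nonneg_right (huM.trans (le_abs_self M)) (norm_nonneg _))
    have h2 : ‖u * f s - f s‖ ≤ (|M| + 1) * ‖f s - b‖ + ‖u * b - b‖ := by
      rw [e]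
      refine (norm_sub_le _ _).trans ?_
      linarith [norm_add_le (u * (f s - b)) (u * b - b)]
    rw [ConvAlg.iA_apply]
    refine h2.trans_lt (lt_of_mul_lt_mul_right ?_ hpos.le)
    nlinarith [abs_nonneg M]
  exact mem_closure_of_tendsto ht (Eventually.of_forall fun u =>
    Submodule.subset_span ⟨u, q f, opA_q u f⟩)

variable (μ R) in
theorem isNondegenerate_canonicalRep_π (hA : HasBoundedLeftApproximateIdentity A) :
    IsNondegenerate (canonicalRep R μ).π := by
  refine dense_closure.1 (denseRange_q.mono ?_)
  rintro _ ⟨f, rfl⟩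
  exact q_mem_closure_span hA f

/-! ### Separation of points by the representations in the class -/

/-- The bounded extension of `π ⋊ U` to the crossed product, for `(π, U) ∈ R`. -/
noncomputable def liftRep {ρ : BanachCovariantRep.{w} S} (hρ : ρ ∈ R.carrier) :
    CrossedProduct R μ →L[𝕜] (ρ.X →L[𝕜] ρ.X) :=
  lift ((CovariantRep.integratedForm μ ρ.isContinuous : ConvAlg S μ →ₙₐ[𝕜] (ρ.X →L[𝕜] ρ.X)) :
    ConvAlg S μ →ₗ[𝕜] (ρ.X →L[𝕜] ρ.X))
    ⟨1, fun f => (R.le_seminorm hρ f).trans_eq (one_mul _).symm⟩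

theorem liftRep_q {ρ : BanachCovariantRep.{w} S} (hρ : ρ ∈ R.carrier) (f : ConvAlg S μ) :
    liftRep hρ (q f : CrossedProduct R μ) = CovariantRep.integratedForm μ ρ.isContinuous f :=
  lift_q _ _ f

theorem norm_liftRep_apply_le {ρ : BanachCovariantRep.{w} S} (hρ : ρ ∈ R.carrier)
    (x : CrossedProduct R μ) : ‖liftRep hρ x‖ ≤ ‖x‖ :=
  (norm_lift_apply_le _ (fun f => (R.le_seminorm hρ f).trans_eq (one_mul _).symm) x).trans_eq
    (one_mul _)

/-- The representations in `R` separate the points of the crossed product. -/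
theorem eq_of_liftRep_eq {x y : CrossedProduct R μ}
    (h : ∀ (ρ : BanachCovariantRep.{w} S) (hρ : ρ ∈ R.carrier), liftRep hρ x = liftRep hρ y) :
    x = y := by
  rw [← sub_eq_zero, ← norm_le_zero_iff]
  refine le_of_forall_pos_le_add fun ε hε => ?_
  obtain ⟨f, hf⟩ := denseRange_q.exists_dist_lt (x - y) (half_pos hε)
  rw [dist_eq_norm] at hf
  have hσ : ‖(q f : CrossedProduct R μ)‖ ≤ ε / 2 := by
    rw [norm_q]
    refine R.seminorm_le fun ρ hρ => ?_
    -- As `Φ` kills `x - y`, the norm of `Φ(q f)` equals that of `Φ(x - y - q f)`, which is small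
    -- since `Φ` is contractive.
    have hz : liftRep hρ (x - y) = 0 := by rw [map_sub, h ρ hρ, sub_self]
    rw [← liftRep_q hρ, ← norm_neg, ← zero_sub, ← hz, ← map_sub]
    exact (norm_liftRep_apply_le hρ _).trans hf.le
  have := norm_add_le (x - y - q f) (q f)
  rw [sub_add_cancel] at this
  linarith

/-- Both sides are continuous in `x` and agree on each `q f` by `integratedForm_iA`. With
`liftRep_opG`, this turns the integrand of `i_A^R ⋊ i_G^R` into that of `π ⋊ U`. -/
theorem liftRep_opA {ρ : BanachCovariantRep.{w} S} (hρ : ρ ∈ R.carrier) (a : A)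
    (x : CrossedProduct R μ) : liftRep hρ (opA a x) = ρ.rep.π a * liftRep hρ x := by
  refine congrFun (ext_of_q (F := fun x => liftRep hρ (opA a x))
    (H := fun x => ρ.rep.π a * liftRep hρ x) (by fun_prop) (by fun_prop) fun f => ?_) x
  simp only [opA_q, liftRep_q, CovariantRep.integratedForm_iA]

theorem liftRep_opG {ρ : BanachCovariantRep.{w} S} (hρ : ρ ∈ R.carrier) (r : G)
    (x : CrossedProduct R μ) : liftRep hρ (opG r x) = ρ.rep.U r * liftRep hρ x := by
  refine congrFun (ext_of_q (F := fun x => liftRep hρ (opG r x))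
    (H := fun x => ρ.rep.U r * liftRep hρ x) (by fun_prop) (by fun_prop) fun f => ?_) x
  simp only [opG_q, liftRep_q, CovariantRep.integratedForm_iG]

/-! ### Identification with the left regular representation -/

/-- The integrated form of the canonical covariant representation is left multiplication. -/
theorem integratedForm_canonicalRep (f : ConvAlg S μ) :
    CovariantRep.integratedForm μ (canonicalRep_isContinuous μ R) f =
      NonUnitalAlgHom.Lmul 𝕜 (CrossedProduct R μ) (q f) := by
  refine op_ext fun g => ?_
  change _ = q f * q g
  rw [← q_mul, CovariantRep.integratedForm_apply]
  refine eq_of_liftRep_eq fun ρ hρ => ?_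
  ext x
  -- The bounded map `c ↦ Φ(c) x` moves under the integral, so the comparison takes place in the
  -- representation space of `ρ`.
  have hmap := map_integral 𝕜 (μ := μ)
    ((ContinuousLinearMap.apply 𝕜 ρ.X x).comp (liftRep (R := R) (μ := μ) hρ))
    (CovariantRep.continuous_integrand (canonicalRep_isContinuous μ R) f (q g))
    (CovariantRep.hasCompactSupport_integrand f (q g))
  refine hmap.trans ?_
  rw [liftRep_q, map_mul]
  -- Multiplicativity of `π ⋊ U` presents the right-hand side as the integral defining `π ⋊ U (f)`
  -- at the vector `π ⋊ U (g) x`; it remains to compare integrands.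
  change _ = CovariantRep.integratedForm μ ρ.isContinuous f
    (CovariantRep.integratedForm μ ρ.isContinuous g x)
  rw [CovariantRep.integratedForm_apply]
  congr 1; funext s
  change liftRep hρ (opA (f s) (opG s (q g))) x = _
  rw [liftRep_opA, liftRep_opG, liftRep_q]
  rfl

theorem norm_Lmul_le (c : CrossedProduct R μ) :
    ‖NonUnitalAlgHom.Lmul 𝕜 (CrossedProduct R μ) c‖ ≤ ‖c‖ :=
  ContinuousLinearMap.opNorm_mul_apply_le 𝕜 (CrossedProduct R μ) c

variable (μ R) in
theorem canonicalRep_isRContinuous : (canonicalRep R μ).IsRContinuous R μ :=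
  ⟨canonicalRep_isContinuous μ R, 1, fun f => by
    rw [integratedForm_canonicalRep, one_mul, ← norm_q]
    exact norm_Lmul_le _⟩

/-- Both maps are continuous and agree on the dense range of `q`. As a bare algebra homomorphism,
`integratedFormR h` carries no continuity; it is supplied by the underlying `lift`. -/
theorem integratedFormR_canonicalRep (h : (canonicalRep R μ).IsRContinuous R μ) :
    CovariantRep.integratedFormR h = NonUnitalAlgHom.Lmul 𝕜 (CrossedProduct R μ) := by
  refine DFunLike.coe_injective (ext_of_q
    (ContinuousLinearMap.continuous (CrossedProduct.lift
      ((CovariantRep.integratedForm μ h.choose :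
        ConvAlg S μ →ₙₐ[𝕜] (CrossedProduct R μ →L[𝕜] CrossedProduct R μ)) :
      ConvAlg S μ →ₗ[𝕜] (CrossedProduct R μ →L[𝕜] CrossedProduct R μ)) h.choose_spec))
    (ContinuousLinearMap.mul 𝕜 (CrossedProduct R μ)).continuous fun f => ?_)
  rw [CovariantRep.integratedFormR_q, integratedForm_canonicalRep]

end CrossedProduct

end CrossedProduct

end BanachCrossedProduct

theorem theoremt {𝕜 : Type*} [RCLike 𝕜]
    {A : Type*} [NonUnitalNormedRing A] [NormedSpace 𝕜 A] [IsScalarTower 𝕜 A A]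
    [SMulCommClass 𝕜 A A] [CompleteSpace A]
    {G : Type*} [Group G] [TopologicalSpace G] [IsTopologicalGroup G] [LocallyCompactSpace G]
    [T2Space G] [MeasurableSpace G] [BorelSpace G]
    (μ : MeasureTheory.Measure G) [μ.IsHaarMeasure]
    (S : BanachCrossedProduct.DynamicalSystem 𝕜 A G)
    (hA : BanachCrossedProduct.HasBoundedLeftApproximateIdentity A)
    (R : BanachCrossedProduct.UniformlyBoundedClass.{w} S)
    (hR : ∀ ρ ∈ R.carrier, BanachCrossedProduct.IsNondegenerate ρ.rep.π) :
    BanachCrossedProduct.IsNondegenerate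
        (BanachCrossedProduct.CrossedProduct.canonicalRep R μ).π ∧
      ∃ h : (BanachCrossedProduct.CrossedProduct.canonicalRep R μ).IsRContinuous R μ,
        BanachCrossedProduct.IsNondegenerate
          (BanachCrossedProduct.CovariantRep.integratedFormR h) ∧
        BanachCrossedProduct.CovariantRep.integratedFormR h =
          NonUnitalAlgHom.Lmul 𝕜 (BanachCrossedProduct.CrossedProduct R μ) ∧
        ∀ c : BanachCrossedProduct.CrossedProduct R μ,
          ‖BanachCrossedProduct.CovariantRep.integratedFormR h c‖ ≤ ‖c‖ := by
  have hnd := BanachCrossedProduct.CrossedProduct.isNondegenerate_canonicalRep_π μ R hA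
  have h := BanachCrossedProduct.CrossedProduct.canonicalRep_isRContinuous μ R
  refine ⟨hnd, h, BanachCrossedProduct.CovariantRep.isNondegenerate_integratedFormR h hnd,
    BanachCrossedProduct.CrossedProduct.integratedFormR_canonicalRep h, fun c => ?_⟩
  -- Contractivity is submultiplicativity of the norm, once the representation is known to be left
  -- multiplication.
  rw [BanachCrossedProduct.CrossedProduct.integratedFormR_canonicalRep]
  exact BanachCrossedProduct.CrossedProduct.norm_Lmul_le c
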